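/- For an integer $d \ge 1$, a nonempty set $I \subseteq \{1,\dots,d\}$ and $0 \le \rho \le 1$, let $\mu_{I,\rho}$ be the probability distribution on $\{-1,1\}^d$ with $\mu_{I,\rho}(x) = 2^{-d}\bigl(1 + \rho \prod_{i \in I} x_i\bigr)$, and for a family $\mathcal{U}$ of nonempty subsets of $\{1,\dots,d\}$ let $\mathcal{P}_{\mathcal{U},\rho} = \{\mu_{I,\rho} : I \in \mathcal{U}\}$, indexed by $\mathcal{U}$. For integers $t,s,\ell \ge 1$, a $(t,s,\ell)$-algorithm identifying $\mu \in \mathcal{P}_{\mathcal{U},\rho}$ with error $\varepsilon$ is an algorithm that goes $\ell$ times, in order, over $t$ data points in $\{-1,1\}^d$ with $s$ bits of memory: with $x_1,\dots,x_{t\ell}$ denoting $\ell$ consecutive copies of the data set, it computes $u_{i+1} = f_i(x_i,u_i)$ with $u_i \in \{0,1\}^s$, where the initial state $u_1$ is fixed and the functions $f_i$ are arbitrary, and its output is a function of $u_{t\ell+1}$; it is required that for every $I \in \mathcal{U}$, if the $t$ data points are i.i.d. samples from $\mu_{I,\rho}$, then the output is $I$ with probability at least $1-\varepsilon$. **Theorem.**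 There are numerical constants $C, C' > 0$ such that the following holds. Let $d \ge 1$ be an integer, let $\mathcal{U}$ be a family of nonempty subsets of $\{1,\dots,d\}$ with $|\mathcal{U}| \ge C'$, let $0 \le \rho \le 1$ satisfy $\rho \le |\mathcal{U}|^{-3} \ln^{-1/2}|\mathcal{U}| \, C^{-1}$, and let $t,s,\ell \ge 1$ be integers. Then any $(t,s,\ell)$-algorithm identifying $\mu \in \mathcal{P}_{\mathcal{U},\rho}$ with error $1/3$ satisfies $$ts\ell \ \ge\ \frac{|\mathcal{U}|}{C \rho^2 \ln|\mathcal{U}|},$$ where for $\rho = 0$ the right-hand side is read as $+\infty$ (that is, no such algorithm exists). For example, detecting pairwise correlations requires $ts\ell = \tilde\Omega(d^2/\rho^2)$. Precisely, there are numerical constants $C > 0$ and $d_0$ such that, if $d \ge d_0$, $\mathcal{U}$ is the family of all two-element subsets of $\{1,\dots,d\}$, and $0 \le \rho \le 1$ satisfies $\rho \le d^{-6} \ln^{-1/2}(d)\, C^{-1}$, then any $(t,s,\ell)$-algorithm identifying $\mu \in \mathcal{P}_{\mathcal{U},\rho}$ with error $1/3$ satisfies $ts\ell \ge d^2/(C\rho^2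 \ln d)$, with the same reading for $\rho = 0$. -/

import Mathlib

noncomputable section

namespace MemoryLowerBound

/-! ### Memory-limited algorithms -/

/-- The `2 ^ s` possible contents of a memory of `s` bits. -/
abbrev Memory (s : ℕ) : Type := Fin s → Bool

/-- An algorithm that makes `ℓ` sequential passes over `t` data points of the sample space `Ω`
with `s` bits of memory and then outputs an element of `ι`. It consists of an initial memory
content, an arbitrary update function for each pass `p` and each position `j` in the data set
(that is, for each of the `t * ℓ` steps), and an arbitrary function from the final memory content
to the output. -/
structure MemoryAlgorithm (Ω : Type*) (t s ℓ : ℕ) (ι : Type*) where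
  /-- the memory content before the first step -/
  init : Memory s
  /-- the update in pass `p` at data point number `j` -/
  update : Fin ℓ → Fin t → Ω → Memory s → Memory s
  /-- the output, as a function of the final memory content -/
  output : Memory s → ι

namespace MemoryAlgorithm

variable {Ω ι : Type*} {t s ℓ : ℕ}

/-- The memory content after pass `p` over the data set `x`, when it was `u` before that pass. -/
def runPass (A : MemoryAlgorithm Ω t s ℓ ι) (x : Fin t → Ω) (p : Fin ℓ) (u : Memory s) :
    Memory s :=
  Fin.foldl t (fun v j => A.update p j (x j) v) u

/-- The memory content after all `ℓ` passes over the data set `x`. -/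
def finalMemory (A : MemoryAlgorithm Ω t s ℓ ι) (x : Fin t → Ω) : Memory s :=
  Fin.foldl ℓ (fun u p => A.runPass x p u) A.init

/-- The output of the algorithm on the data set `x`. -/
def run (A : MemoryAlgorithm Ω t s ℓ ι) (x : Fin t → Ω) : ι :=
  A.output (A.finalMemory x)

end MemoryAlgorithm

/-! ### Samples and identification -/

/-- The distribution of `t` i.i.d. samples from a distribution `μ` on a finite sample space. -/
def iidSample {Ω : Type*} [Fintype Ω] (μ : PMF Ω) (t : ℕ) : PMF (Fin t → Ω) :=
  PMF.ofFintype (fun x => ∏ j, μ (x j)) (by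
    classical
    have h := Finset.prod_univ_sum (fun _ : Fin t => (Finset.univ : Finset Ω)) (fun _ a => μ a)
    rw [Fintype.piFinset_univ] at h
    rw [← h]
    have h1 : ∑ a, μ a = 1 := (tsum_fintype (fun a => μ a)).symm.trans μ.tsum_coe
    simp [h1])

/-- The algorithm `A` identifies `μ ∈ {μ i | i}` with error `ε`: for every index `i`, on `t` i.i.d.
samples from `μ i` it outputs `i` with probability at least `1 - ε`. -/
def MemoryAlgorithm.Identifies {Ω ι : Type*} [Fintype Ω] {t s ℓ : ℕ}
    (A : MemoryAlgorithm Ω t s ℓ ι) (μ : ι → PMF Ω) (ε : ℝ) : Prop :=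
  ∀ i, 1 - ε ≤ (((iidSample (μ i) t).map A.run) i).toReal

/-! ### Parity-biased distributions -/

/-- The cube `{-1, 1} ^ d`. -/
abbrev Cube (d : ℕ) : Type := Fin d → ℤˣ

/-- The product `∏ i ∈ I, x i` as a real number. -/
def parity {d : ℕ} (I : Finset (Fin d)) (x : Cube d) : ℝ := ∏ i ∈ I, ((x i : ℤ) : ℝ)

theorem parity_eq_or {d : ℕ} (I : Finset (Fin d)) (x : Cube d) :
    parity I x = 1 ∨ parity I x = -1 := by
  have h : parity I x = (((∏ i ∈ I, x i : ℤˣ) : ℤ) : ℝ) := by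
    simp [parity]
  rcases Int.units_eq_one_or (∏ i ∈ I, x i) with h1 | h1 <;> simp [h, h1]

theorem sum_parity {d : ℕ} {I : Finset (Fin d)} (hI : I.Nonempty) :
    ∑ x : Cube d, parity I x = 0 := by
  classical
  have h := Finset.prod_univ_sum (fun _ : Fin d => (Finset.univ : Finset ℤˣ))
    (fun i a => if i ∈ I then ((a : ℤ) : ℝ) else 1)
  rw [Fintype.piFinset_univ] at h
  have h2 : ∀ x : Cube d,
      parity I x = ∏ i, if i ∈ I then ((x i : ℤ) : ℝ) else 1 := by
    intro x
    rw [parity, Finset.prod_ite_mem]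
    simp
  simp_rw [h2]
  rw [← h]
  obtain ⟨i, hi⟩ := hI
  refine Finset.prod_eq_zero (Finset.mem_univ i) ?_
  simp [hi]

/-- The mass `2⁻ᵈ (1 + ρ ∏ i ∈ I, x i)` of the point `x` of the cube. -/
def parityMass {d : ℕ} (I : Finset (Fin d)) (ρ : ℝ) (x : Cube d) : ℝ :=
  (1 + ρ * parity I x) / 2 ^ d

theorem parityMass_nonneg {d : ℕ} (I : Finset (Fin d)) {ρ : ℝ} (hρ : ρ ∈ Set.Icc (0 : ℝ) 1)
    (x : Cube d) : 0 ≤ parityMass I ρ x := by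
  obtain ⟨h0, h1⟩ := hρ
  unfold parityMass
  refine div_nonneg ?_ (by positivity)
  rcases parity_eq_or I x with h | h <;> rw [h] <;> linarith

theorem sum_parityMass {d : ℕ} {I : Finset (Fin d)} (hI : I.Nonempty) (ρ : ℝ) :
    ∑ x : Cube d, parityMass I ρ x = 1 := by
  unfold parityMass
  rw [← Finset.sum_div, Finset.sum_add_distrib, ← Finset.mul_sum, sum_parity hI]
  simp

/-- The distribution on the cube that gives `x` the probability `2⁻ᵈ (1 + ρ ∏ i ∈ I, x i)`. -/
def parityBiased {d : ℕ} (I : Finset (Fin d)) (hI : I.Nonempty) (ρ : ℝ)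
    (hρ : ρ ∈ Set.Icc (0 : ℝ) 1) : PMF (Cube d) :=
  PMF.ofFintype (fun x => ENNReal.ofReal (parityMass I ρ x)) (by
    rw [← ENNReal.ofReal_sum_of_nonneg (fun x _ => parityMass_nonneg I hρ x),
      sum_parityMass hI, ENNReal.ofReal_one])

/-- The family of the parity-biased distributions with parameter `ρ` of the sets `I` in `U`. -/
def parityFamily {d : ℕ} (U : Finset (Finset (Fin d))) (hU : ∀ I ∈ U, I.Nonempty) (ρ : ℝ)
    (hρ : ρ ∈ Set.Icc (0 : ℝ) 1) : U → PMF (Cube d) :=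
  fun I => parityBiased I.1 (hU I.1 I.2) ρ hρ

/-- The family of all sets of two coordinates. -/
def coordPairs (d : ℕ) : Finset (Finset (Fin d)) := Finset.powersetCard 2 Finset.univ

theorem nonempty_of_mem_coordPairs {d : ℕ} : ∀ I ∈ coordPairs d, I.Nonempty := by
  intro I hI
  have h := (Finset.mem_powersetCard.mp hI).2
  exact Finset.card_pos.mp (by omega)

end MemoryLowerBound

end

noncomputable section

namespace MemoryLowerBound

open Finset Real

/-! ### Elementary inequalities -/

/-! The data set is cut into `m` blocks of `k` points, and the algorithm becomes a protocol among
`m` players, one per block. The transcript consists of the memory contents at block ends; in all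
passes together each player writes at most `b = s * ℓ` bits. Let `n` be the number of hypotheses.
The null distribution (unbiased data) is the same for all of them, and its output probabilities sum
to one, so for most `i` the planted transcript must be told apart from the null transcript.

Compatibility with a transcript is a separate condition on each block, so transcript probabilities
are products over players and the relative entropy of null against planted is a sum over players. A
second-order bound on the logarithm replaces it by the energy, the expected squared shifts under the
null (`le_totalEnergy`). For fixed inputs of the other players, the transcript is a function of one
block with at most `2 ^ b` values, and the shift is the conditional mean, given that function, of
the block's likelihood ratio minus one (`sum_rectShift_sq_le`).

To first order this ratio minus one is `ρ` times the block sum of `χ i`. The decisive estimate is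
simultaneous in `i`: by the level-one inequality, `b` bits carry second moment `O(b k)` about all
`n` block sums together, not about each (`OrthoSigns.mul_norm_le`,
`OrthoSigns.sum_condEnergy_blockSum_le`). Over all blocks the energies thus sum to `O(m k b ρ²)`,
which is `O(t s ℓ ρ²)`, while success needs their sum to be of order `n`
(`MemoryAlgorithm.card_le_of_outputMass`). The choice of `k` in
`MemoryAlgorithm.card_le_mul_of_identifies` makes the higher-order terms and the truncation of the
likelihood ratio negligible. The result has no logarithmic loss, and parities are one instance of
`OrthoSigns`. -/

theorem exp_sub_sq_le {z : ℝ} (hz : -(1 / 2) ≤ z) : exp (z - z ^ 2) ≤ 1 + z := by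
  rcases le_total 0 z with h0 | h0
  · rcases le_total z 1 with h1 | h1
    · have h2 : |z - z ^ 2| ≤ 1 := by rw [abs_le]; constructor <;> nlinarith
      have h3 := (abs_le.mp (abs_exp_sub_one_sub_id_le h2)).2
      have h4 : (z - z ^ 2) ^ 2 ≤ z ^ 2 := by
        have : (z - z ^ 2) ^ 2 = z ^ 2 * (1 - z) ^ 2 := by ring
        rw [this]
        exact mul_le_of_le_one_right (sq_nonneg z) (by nlinarith)
      linarith
    · have : exp (z - z ^ 2) ≤ 1 := exp_le_one_iff.mpr (by nlinarith)
      linarith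
  · obtain ⟨u, rfl⟩ : ∃ u, z = -u := ⟨-z, by ring⟩
    have hu0 : 0 ≤ u := by linarith
    have hu1 : u ≤ 1 / 2 := by linarith
    have h1 := quadratic_le_exp_of_nonneg (x := u + u ^ 2) (by positivity)
    have h2 : -u - (-u) ^ 2 = -(u + u ^ 2) := by ring
    rw [h2, exp_neg]
    refine inv_le_of_inv_le₀ (by linarith) (le_trans ?_ h1)
    rw [inv_le_iff_one_le_mul₀ (by linarith)]
    -- Half of this product is `(1 - u) * (1 + v + v ^ 2 / 2) - 1` with `v = u + u ^ 2`.
    have h3 : 0 ≤ u ^ 2 * (1 - u - u ^ 2 - u ^ 3) := by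
      refine mul_nonneg (sq_nonneg u) ?_
      have : u ^ 2 ≤ 1 / 4 := by nlinarith
      have : u ^ 3 ≤ 1 / 8 := by nlinarith
      linarith
    nlinarith

theorem sub_sq_le_log {z : ℝ} (hz : -(1 / 2) ≤ z) : z - z ^ 2 ≤ log (1 + z) := by
  rw [le_log_iff_exp_le (by linarith)]
  exact exp_sub_sq_le hz

theorem pow_sub_one_sub_le {ρ : ℝ} {k : ℕ} (hx : k * ρ ^ 2 ≤ 1) :
    (1 + ρ ^ 2) ^ k - 1 - k * ρ ^ 2 ≤ (k * ρ ^ 2) ^ 2 := by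
  have h0 : 0 ≤ k * ρ ^ 2 := by positivity
  have h1 : (1 + ρ ^ 2) ^ k ≤ exp (k * ρ ^ 2) := by
    rw [exp_nat_mul]
    refine pow_le_pow_left₀ (by positivity) ?_ _
    linarith [add_one_le_exp (ρ ^ 2)]
  have h2 := (abs_le.mp (abs_exp_sub_one_sub_id_le (x := k * ρ ^ 2)
    (by rw [abs_of_nonneg h0]; exact hx))).2
  linarith

theorem sq_mul_exp_neg_le {n : ℝ} (hn : 1200 ≤ n) : n ^ 2 * exp (-(n / 4)) ≤ 0.05 := by
  have h1 : n / 16 ≤ exp (n / 16) := by linarith [add_one_le_exp (n / 16)]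
  have h2 : (n / 16) ^ 4 ≤ exp (n / 4) := by
    rw [show n / 4 = (4 : ℕ) * (n / 16) by push_cast; ring, exp_nat_mul]
    exact pow_le_pow_left₀ (by linarith) h1 4
  rw [exp_neg, ← div_eq_mul_inv, div_le_iff₀ (exp_pos _)]
  -- `1310720 = 20 * 16 ^ 4`, and `1200 ^ 2` exceeds it; this is where the threshold `1200` is
  -- needed.
  have h3 : n ^ 2 * 1310720 ≤ n ^ 2 * n ^ 2 :=
    mul_le_mul_of_nonneg_left (by nlinarith) (sq_nonneg n)
  nlinarith

/-! ### Product weights -/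

section ProductWeights

variable {κ Ω : Type*} [Fintype κ]

/-- The product weight of a tuple. -/
def prodWeight (w : Ω → ℝ) (y : κ → Ω) : ℝ := ∏ i, w (y i)

theorem prodWeight_nonneg {w : Ω → ℝ} (hw : ∀ a, 0 ≤ w a) (y : κ → Ω) : 0 ≤ prodWeight w y :=
  prod_nonneg fun _ _ => hw _

variable [Fintype Ω] [DecidableEq κ]

theorem sum_prodWeight_mul_prod (w : Ω → ℝ) (f : κ → Ω → ℝ) :
    ∑ y : κ → Ω, prodWeight w y * ∏ i, f i (y i) = ∏ i, ∑ a, w a * f i a := by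
  rw [Fintype.prod_sum]
  simp only [prodWeight, prod_mul_distrib]

theorem sum_prodWeight {w : Ω → ℝ} (hw : ∑ a, w a = 1) :
    ∑ y : κ → Ω, prodWeight w y = 1 := by
  have h := sum_prodWeight_mul_prod (κ := κ) w (fun _ _ => 1)
  simpa [hw] using h

end ProductWeights

/-! ### Orthonormal signs -/

/-- The functions `χ i` take the values `±1`, have mean zero and are pairwise uncorrelated with
respect to the probability weights `w`. -/
structure OrthoSigns {Ω ι : Type*} [Fintype Ω] (w : Ω → ℝ) (χ : ι → Ω → ℝ) : Prop where
  nonneg : ∀ a, 0 ≤ w a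
  sum_one : ∑ a, w a = 1
  sq_eq_one : ∀ i a, χ i a ^ 2 = 1
  mean_zero : ∀ i, ∑ a, w a * χ i a = 0
  orthogonal : ∀ i j, i ≠ j → ∑ a, w a * (χ i a * χ j a) = 0

/-- The sum of a function over the entries of a block. -/
def blockSum {κ Ω : Type*} [Fintype κ] (f : Ω → ℝ) (y : κ → Ω) : ℝ := ∑ j, f (y j)

/-- The likelihood ratio `∏ (1 + ρ f)` of a block. -/
def likelihood {κ Ω : Type*} [Fintype κ] (ρ : ℝ) (f : Ω → ℝ) (y : κ → Ω) : ℝ :=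
  ∏ j, (1 + ρ * f (y j))

namespace OrthoSigns

variable {Ω ι κ : Type*} [Fintype Ω] [Fintype κ] {w : Ω → ℝ} {χ : ι → Ω → ℝ}

theorem abs_eq_one (h : OrthoSigns w χ) (i : ι) (a : Ω) : |χ i a| = 1 := by
  have := h.sq_eq_one i a
  exact (pow_eq_one_iff_of_nonneg (abs_nonneg _) two_ne_zero).mp (by rwa [sq_abs])

theorem sum_sq (h : OrthoSigns w χ) [Fintype ι] [DecidableEq ι] (c : ι → ℝ) :
    ∑ a, w a * (∑ i, c i * χ i a) ^ 2 = ∑ i, c i ^ 2 := by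
  have h1 : ∀ a, w a * (∑ i, c i * χ i a) ^ 2 =
      ∑ i, ∑ j, c i * c j * (w a * (χ i a * χ j a)) := by
    intro a
    rw [sq, sum_mul_sum, mul_sum]
    refine sum_congr rfl fun i _ => ?_
    rw [mul_sum]
    exact sum_congr rfl fun j _ => by ring
  simp_rw [h1]
  rw [sum_comm]
  refine sum_congr rfl fun i _ => ?_
  rw [sum_comm, sum_eq_single i]
  · rw [← mul_sum]
    have : ∑ a, w a * (χ i a * χ i a) = 1 := by
      rw [← h.sum_one]
      exact sum_congr rfl fun a _ => by rw [← sq, h.sq_eq_one, mul_one]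
    rw [this]; ring
  · intro j _ hj
    rw [← mul_sum, h.orthogonal i j hj.symm, mul_zero]
  · simp

theorem sum_linear (h : OrthoSigns w χ) [Fintype ι] (c : ι → ℝ) :
    ∑ a, w a * (∑ i, c i * χ i a) = 0 := by
  simp_rw [mul_sum]
  rw [sum_comm]
  refine sum_eq_zero fun i _ => ?_
  have : ∀ a, w a * (c i * χ i a) = c i * (w a * χ i a) := fun a => by ring
  simp_rw [this]
  rw [← mul_sum, h.mean_zero, mul_zero]

/-- The hypothesis on `c` and Cauchy–Schwarz keep the exponent in `[-1, 1]`, where `exp z ≤ 1 + z +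
z ^ 2`; the mean vanishes and Parseval evaluates the square. The variance proxy is therefore
dimension-free, although the signs need not be independent. -/
theorem sum_exp_le (h : OrthoSigns w χ) [Fintype ι] [DecidableEq ι] (c : ι → ℝ)
    (hc : (∑ i, c i ^ 2) * Fintype.card ι ≤ 1) :
    ∑ a, w a * exp (∑ i, c i * χ i a) ≤ exp (∑ i, c i ^ 2) := by
  have h1 : ∀ a, exp (∑ i, c i * χ i a) ≤ 1 + (∑ i, c i * χ i a) + (∑ i, c i * χ i a) ^ 2 := by
    intro a
    have hsq : (∑ i, c i * χ i a) ^ 2 ≤ 1 := by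
      refine le_trans (sum_mul_sq_le_sq_mul_sq _ _ _) ?_
      simpa [h.sq_eq_one] using hc
    have habs : |∑ i, c i * χ i a| ≤ 1 := by
      rwa [← sq_le_one_iff_abs_le_one]
    have := (abs_le.mp (abs_exp_sub_one_sub_id_le habs)).2
    linarith
  calc ∑ a, w a * exp (∑ i, c i * χ i a)
      ≤ ∑ a, (w a + w a * (∑ i, c i * χ i a) + w a * (∑ i, c i * χ i a) ^ 2) := by
        refine sum_le_sum fun a _ => ?_
        have := mul_le_mul_of_nonneg_left (h1 a) (h.nonneg a)
        linarith
    _ = 1 + ∑ i, c i ^ 2 := by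
        rw [sum_add_distrib, sum_add_distrib, h.sum_one, h.sum_linear, h.sum_sq]; ring
    _ ≤ exp (∑ i, c i ^ 2) := by
        have := add_one_le_exp (∑ i, c i ^ 2)
        linarith

variable [DecidableEq κ]

theorem sum_prodWeight_exp_le (h : OrthoSigns w χ) [Fintype ι] [DecidableEq ι] (c : ι → ℝ)
    (hc : (∑ i, c i ^ 2) * Fintype.card ι ≤ 1) :
    ∑ y : κ → Ω, prodWeight w y * exp (∑ i, c i * blockSum (χ i) y) ≤
      exp (Fintype.card κ * ∑ i, c i ^ 2) := by
  have h1 : ∀ y : κ → Ω, exp (∑ i, c i * blockSum (χ i) y) =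
      ∏ j, exp (∑ i, c i * χ i (y j)) := by
    intro y
    rw [← exp_sum]
    congr 1
    simp only [blockSum, mul_sum]
    rw [sum_comm]
  simp_rw [h1]
  rw [sum_prodWeight_mul_prod w (fun _ a => exp (∑ i, c i * χ i a)), prod_const, exp_nat_mul,
    card_univ]
  refine pow_le_pow_left₀ (sum_nonneg fun a _ => mul_nonneg (h.nonneg a) (exp_pos _).le)
    (h.sum_exp_le c hc) _

theorem sum_linear_likelihood (h : OrthoSigns w χ) (ρ : ℝ) (i : ι) :
    ∑ a, w a * (1 + ρ * χ i a) = 1 := by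
  have : ∀ a, w a * (1 + ρ * χ i a) = w a + ρ * (w a * χ i a) := fun a => by ring
  simp_rw [this]
  rw [sum_add_distrib, ← mul_sum, h.mean_zero, h.sum_one]; ring

theorem sum_likelihood (h : OrthoSigns w χ) (ρ : ℝ) (i : ι) :
    ∑ y : κ → Ω, prodWeight w y * likelihood ρ (χ i) y = 1 := by
  unfold likelihood
  rw [sum_prodWeight_mul_prod w (fun _ a => 1 + ρ * χ i a)]
  simp [h.sum_linear_likelihood]

theorem sum_likelihood_sq (h : OrthoSigns w χ) (ρ : ℝ) (i : ι) :
    ∑ y : κ → Ω, prodWeight w y * likelihood ρ (χ i) y ^ 2 = (1 + ρ ^ 2) ^ Fintype.card κ := by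
  unfold likelihood
  simp_rw [← prod_pow]
  rw [sum_prodWeight_mul_prod w (fun _ a => (1 + ρ * χ i a) ^ 2)]
  have h1 : ∀ a, w a * (1 + ρ * χ i a) ^ 2 = w a * (1 + ρ ^ 2) + 2 * ρ * (w a * χ i a) := by
    intro a
    linear_combination w a * ρ ^ 2 * h.sq_eq_one i a
  simp_rw [h1]
  rw [sum_add_distrib, ← mul_sum, ← sum_mul, h.mean_zero, h.sum_one]
  simp

theorem sum_mul_likelihood (h : OrthoSigns w χ) (ρ : ℝ) (i : ι) (j : κ) :
    ∑ y : κ → Ω, prodWeight w y * (χ i (y j) * likelihood ρ (χ i) y) = ρ := by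
  have h1 : ∀ y : κ → Ω, χ i (y j) * likelihood ρ (χ i) y =
      ∏ l, ((if l = j then χ i (y l) else 1) * (1 + ρ * χ i (y l))) := by
    intro y
    rw [prod_mul_distrib, prod_ite_eq' univ j]
    simp [likelihood]
  simp_rw [h1]
  rw [sum_prodWeight_mul_prod w (fun l a => (if l = j then χ i a else 1) * (1 + ρ * χ i a)),
    prod_eq_single j]
  · have h2 : ∀ a, w a * (χ i a * (1 + ρ * χ i a)) = w a * χ i a + ρ * w a := by
      intro a
      linear_combination w a * ρ * h.sq_eq_one i a
    simp only [if_true]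
    simp_rw [h2]
    rw [sum_add_distrib, ← mul_sum, h.mean_zero, h.sum_one]; ring
  · intro l _ hl
    simp [hl, h.sum_linear_likelihood]
  · simp

theorem sum_blockSum_mul_likelihood (h : OrthoSigns w χ) (ρ : ℝ) (i : ι) :
    ∑ y : κ → Ω, prodWeight w y * (blockSum (χ i) y * likelihood ρ (χ i) y) =
      Fintype.card κ * ρ := by
  simp_rw [blockSum, sum_mul, mul_sum]
  rw [sum_comm]
  simp [h.sum_mul_likelihood]

theorem sum_blockSum (h : OrthoSigns w χ) (i : ι) :
    ∑ y : κ → Ω, prodWeight w y * blockSum (χ i) y = 0 := by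
  have := h.sum_blockSum_mul_likelihood (κ := κ) 0 i
  simpa [likelihood] using this

theorem sum_blockSum_sq (h : OrthoSigns w χ) (i : ι) :
    ∑ y : κ → Ω, prodWeight w y * blockSum (χ i) y ^ 2 = Fintype.card κ := by
  have key : ∀ j l : κ, ∑ y : κ → Ω, prodWeight w y * (χ i (y j) * χ i (y l)) =
      if j = l then 1 else 0 := by
    intro j l
    split_ifs with hjl
    · subst hjl
      rw [← sum_prodWeight (κ := κ) h.sum_one]
      exact sum_congr rfl fun y _ => by rw [← sq, h.sq_eq_one, mul_one]
    · have h1 : ∀ y : κ → Ω, χ i (y j) * χ i (y l) =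
          ∏ p, ((if p = j then χ i (y p) else 1) * (if p = l then χ i (y p) else 1)) := by
        intro y
        rw [prod_mul_distrib, prod_ite_eq' univ j, prod_ite_eq' univ l]
        simp
      simp_rw [h1]
      rw [sum_prodWeight_mul_prod w
        (fun p a => (if p = j then χ i a else 1) * (if p = l then χ i a else 1))]
      refine prod_eq_zero (mem_univ j) ?_
      simp [hjl, h.mean_zero]
  have h2 : ∀ y : κ → Ω, prodWeight w y * blockSum (χ i) y ^ 2 =
      ∑ j, ∑ l, prodWeight w y * (χ i (y j) * χ i (y l)) := by
    intro y
    rw [blockSum, sq, sum_mul_sum, mul_sum]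
    exact sum_congr rfl fun j _ => by rw [mul_sum]
  simp_rw [h2]
  rw [sum_comm]
  have h3 : ∀ j : κ, ∑ y : κ → Ω, ∑ l, prodWeight w y * (χ i (y j) * χ i (y l)) = 1 := by
    intro j
    rw [sum_comm]
    simp [key]
  simp [h3]

theorem sum_likelihood_sub_one_sq (h : OrthoSigns w χ) (ρ : ℝ) (i : ι) :
    ∑ y : κ → Ω, prodWeight w y * (likelihood ρ (χ i) y - 1) ^ 2 =
      (1 + ρ ^ 2) ^ Fintype.card κ - 1 := by
  have h1 : ∀ y : κ → Ω, prodWeight w y * (likelihood ρ (χ i) y - 1) ^ 2 =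
      prodWeight w y * likelihood ρ (χ i) y ^ 2 - 2 * (prodWeight w y * likelihood ρ (χ i) y)
        + prodWeight w y := fun y => by ring
  simp_rw [h1]
  rw [sum_add_distrib, sum_sub_distrib, ← mul_sum, h.sum_likelihood, h.sum_likelihood_sq,
    sum_prodWeight h.sum_one]
  ring

/-- The likelihood ratio is multilinear in the signs of the block. This is the weight of its terms
of degree at least two, of order `(k ρ²)²`, whereas the linear term has weight `k ρ²`. -/
theorem sum_likelihood_sub_linear_sq (h : OrthoSigns w χ) (ρ : ℝ) (i : ι) :
    ∑ y : κ → Ω, prodWeight w y * (likelihood ρ (χ i) y - 1 - ρ * blockSum (χ i) y) ^ 2 =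
      (1 + ρ ^ 2) ^ Fintype.card κ - 1 - Fintype.card κ * ρ ^ 2 := by
  have h1 : ∀ y : κ → Ω,
      prodWeight w y * (likelihood ρ (χ i) y - 1 - ρ * blockSum (χ i) y) ^ 2 =
      prodWeight w y * (likelihood ρ (χ i) y - 1) ^ 2
        - 2 * ρ * (prodWeight w y * (blockSum (χ i) y * likelihood ρ (χ i) y))
        + 2 * ρ * (prodWeight w y * blockSum (χ i) y)
        + ρ ^ 2 * (prodWeight w y * blockSum (χ i) y ^ 2) := fun y => by ring
  simp_rw [h1]
  rw [sum_add_distrib, sum_add_distrib, sum_sub_distrib, ← mul_sum, ← mul_sum, ← mul_sum,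
    h.sum_likelihood_sub_one_sq, h.sum_blockSum_mul_likelihood, h.sum_blockSum, h.sum_blockSum_sq]
  ring

/-- Chernoff bound for the lower tail of the likelihood ratio. -/
theorem sum_likelihood_lt_half_le (h : OrthoSigns w χ) [Fintype ι] [DecidableEq ι] {ρ : ℝ}
    (hρ0 : 0 ≤ ρ) (hρ1 : ρ ≤ 1 / 2)
    (hx : Fintype.card κ * ρ ^ 2 ≤ 1 / 16) {lam : ℝ} (hlam : 0 ≤ lam)
    (hl : (lam * ρ) ^ 2 * Fintype.card ι ≤ 1) (i : ι) :
    ∑ y : κ → Ω, prodWeight w y * (if likelihood ρ (χ i) y < 1 / 2 then 1 else 0) ≤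
      exp (lam ^ 2 * (Fintype.card κ * ρ ^ 2) - lam / 2) := by
  have hc : ∑ l : ι, (if l = i then -(lam * ρ) else 0) ^ 2 = (lam * ρ) ^ 2 := by
    simp [ite_pow]
  have hexp := h.sum_prodWeight_exp_le (κ := κ) (fun l => if l = i then -(lam * ρ) else 0)
    (by rw [hc]; exact hl)
  rw [hc] at hexp
  have hpt : ∀ y : κ → Ω, (if likelihood ρ (χ i) y < 1 / 2 then (1 : ℝ) else 0) ≤
      exp (-(lam / 2)) * exp (∑ l, (if l = i then -(lam * ρ) else 0) * blockSum (χ l) y) := by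
    intro y
    split_ifs with hy
    · rw [← exp_add]
      refine one_le_exp ?_
      have h1 : exp (ρ * blockSum (χ i) y - Fintype.card κ * ρ ^ 2) ≤ likelihood ρ (χ i) y := by
        have h2 : ρ * blockSum (χ i) y - Fintype.card κ * ρ ^ 2 =
            ∑ j, (ρ * χ i (y j) - ρ ^ 2) := by
          simp [blockSum, mul_sum, sum_sub_distrib]
        rw [h2, exp_sum, likelihood]
        refine prod_le_prod (fun _ _ => (exp_pos _).le) fun j _ => ?_
        have hu := abs_eq_one h i (y j)
        have hu2 := h.sq_eq_one i (y j)
        set u := χ i (y j)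
        have hb : |ρ * u| ≤ 1 / 2 := by rw [abs_mul, hu, abs_of_nonneg hρ0]; linarith
        have hb' := abs_le.mp hb
        have hsq : (ρ * u) ^ 2 = ρ ^ 2 := by rw [mul_pow, hu2, mul_one]
        rw [← hsq]
        exact exp_sub_sq_le (by linarith [hb'.1])
      -- Since `log 2 > 9/16` and `k * ρ ^ 2 ≤ 1/16`, a ratio below `1/2` forces `ρ * blockSum (χ i)
      -- y < -1/2`.
      have h2 : exp (ρ * blockSum (χ i) y - Fintype.card κ * ρ ^ 2) < exp (-(9/16)) := by
        refine lt_of_le_of_lt h1 (lt_of_lt_of_le hy ?_)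
        have := exp_log (show (0 : ℝ) < 1 / 2 by norm_num)
        rw [← this, exp_le_exp, one_div, log_inv]
        linarith [log_two_gt_d9]
      have h3 := exp_lt_exp.mp h2
      simp only [ite_mul, zero_mul, sum_ite_eq', mem_univ, if_true]
      nlinarith
    · positivity
  calc _ ≤ ∑ y : κ → Ω, exp (-(lam / 2)) * (prodWeight w y *
        exp (∑ l, (if l = i then -(lam * ρ) else 0) * blockSum (χ l) y)) := by
        refine sum_le_sum fun y _ => ?_
        have := mul_le_mul_of_nonneg_left (hpt y) (prodWeight_nonneg h.nonneg y)
        linarith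
    _ ≤ exp (-(lam / 2)) * exp (Fintype.card κ * (lam * ρ) ^ 2) := by
        rw [← mul_sum]
        exact mul_le_mul_of_nonneg_left hexp (exp_pos _).le
    _ = _ := by rw [← exp_add]; congr 1; ring

end OrthoSigns

/-! ### Conditional second moments and the level-one inequality -/

open scoped Classical in
/-- The second moment `E[E[g | f]²]` of the conditional expectation of `g` given `f` with respect
to the weights `W`. -/
def condEnergy {Y P : Type*} [Fintype Y] [Fintype P] (W : Y → ℝ) (f : Y → P) (g : Y → ℝ) : ℝ :=
  ∑ p, (∑ y with f y = p, W y * g y) ^ 2 / ∑ y with f y = p, W y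

section condEnergy

variable {Y P : Type*} [Fintype Y] [Fintype P] {W : Y → ℝ}

/-- Conditional expectation is an `L²` contraction: Cauchy–Schwarz on each fibre. Fibres of mass
zero contribute zero by the convention for division. -/
theorem condEnergy_le (hW : ∀ y, 0 ≤ W y) (f : Y → P) (g : Y → ℝ) :
    condEnergy W f g ≤ ∑ y, W y * g y ^ 2 := by
  classical
  have h : ∑ y, W y * g y ^ 2 = ∑ p, ∑ y with f y = p, W y * g y ^ 2 :=
    (sum_fiberwise univ f _).symm
  rw [h]
  refine sum_le_sum fun p _ => ?_
  refine div_le_of_le_mul₀ (sum_nonneg fun y _ => hW y)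
    (sum_nonneg fun y _ => mul_nonneg (hW y) (sq_nonneg _)) ?_
  rw [mul_comm]
  exact sum_sq_le_sum_mul_sum_of_sq_le_mul _ (fun y _ => hW y)
    (fun y _ => mul_nonneg (hW y) (sq_nonneg _)) fun y _ => le_of_eq (by ring)

theorem condEnergy_add_add_le (hW : ∀ y, 0 ≤ W y) (f : Y → P) (g₁ g₂ g₃ : Y → ℝ) :
    condEnergy W f (fun y => g₁ y + g₂ y + g₃ y) ≤
      3 * (condEnergy W f g₁ + condEnergy W f g₂ + condEnergy W f g₃) := by
  classical
  unfold condEnergy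
  rw [← sum_add_distrib, ← sum_add_distrib, mul_sum]
  refine sum_le_sum fun p _ => ?_
  rw [← add_div, ← add_div, ← mul_div_assoc]
  refine div_le_div_of_nonneg_right ?_ (sum_nonneg fun y _ => hW y)
  simp_rw [mul_add, sum_add_distrib]
  set a := ∑ y with f y = p, W y * g₁ y
  set b := ∑ y with f y = p, W y * g₂ y
  set c := ∑ y with f y = p, W y * g₃ y
  nlinarith [sq_nonneg (a - b), sq_nonneg (b - c), sq_nonneg (a - c)]

theorem condEnergy_const_mul (f : Y → P) (c : ℝ) (g : Y → ℝ) :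
    condEnergy W f (fun y => c * g y) = c ^ 2 * condEnergy W f g := by
  classical
  unfold condEnergy
  rw [mul_sum]
  refine sum_congr rfl fun p _ => ?_
  have : ∀ y, W y * (c * g y) = c * (W y * g y) := fun y => by ring
  simp_rw [this]
  rw [← mul_sum, mul_pow, mul_div_assoc]

end condEnergy

/-- If `L + λ²` bounds `λ a` for `λ = 1` and `λ = √(2 b)`, then `exp (-L) * a²` is small. -/
theorem mul_sq_le_of_linear_bounds {p a b : ℝ} (hp : 0 < p) (hp1 : p ≤ 1) (ha : 0 ≤ a)
    (hb : 1 ≤ b) (h1 : a ≤ -log p + 1) (h2 : √(2 * b) * a ≤ -log p + 2 * b) :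
    -- The first term is the case `-log p ≤ 2 * b`, the second the rare events; its factor `exp
    -- (-b)` pays for a sum over `2 ^ b` events.
    p * a ^ 2 ≤ 8 * b * p + 16 * exp (-b) := by
  have hL : 0 ≤ -log p := by linarith [log_nonpos hp.le hp1]
  rcases le_total (-log p) (2 * b) with h | h
  · have h3 : √(2 * b) * a ≤ 4 * b := by linarith
    have h4 : a ^ 2 ≤ 8 * b := by
      have h5 : (√(2 * b) * a) ^ 2 ≤ (4 * b) ^ 2 := pow_le_pow_left₀ (by positivity) h3 2
      rw [mul_pow, sq_sqrt (by linarith)] at h5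
      nlinarith
    have := mul_le_mul_of_nonneg_left h4 hp.le
    have := exp_pos (-b)
    linarith
  · set L := -log p with hLdef
    have hpe : p = exp (-L) := by rw [hLdef, neg_neg, exp_log hp]
    have h3 : a ≤ 4 * exp (L / 4) := by linarith [add_one_le_exp (L / 4)]
    have h4 : a ^ 2 ≤ 16 * exp (L / 2) := by
      have := pow_le_pow_left₀ ha h3 2
      rw [mul_pow, ← exp_nat_mul] at this
      calc a ^ 2 ≤ _ := this
        _ = _ := by norm_num; ring
    calc p * a ^ 2 ≤ p * (16 * exp (L / 2)) := mul_le_mul_of_nonneg_left h4 hp.le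
      _ = 16 * exp (-(L / 2)) := by
        rw [hpe, mul_left_comm, ← exp_add]; congr 2; ring
      _ ≤ 16 * exp (-b) := by
        gcongr; linarith
      _ ≤ _ := by
        have : 0 ≤ 8 * b * p := by positivity
        linarith

namespace OrthoSigns

variable {Ω ι κ P : Type*} [Fintype Ω] [Fintype κ] [Fintype ι] [Fintype P] [DecidableEq κ]
  {w : Ω → ℝ} {χ : ι → Ω → ℝ}

/-- Level-one inequality: conditioning on an event of probability `p` shifts the vector of the
block sums by at most `√k * (log (1 / p) / λ + λ)`. -/
theorem mul_norm_le (h : OrthoSigns w χ) (hk : 0 < Fintype.card κ) (s : Finset (κ → Ω))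
    (hs : 0 < ∑ y ∈ s, prodWeight w y) {lam : ℝ} (hlam : lam ^ 2 * Fintype.card ι ≤ Fintype.card κ) :
    lam * √((∑ i, ((∑ y ∈ s, prodWeight w y * blockSum (χ i) y) / ∑ y ∈ s, prodWeight w y) ^ 2)
      / Fintype.card κ) ≤ -log (∑ y ∈ s, prodWeight w y) + lam ^ 2 := by
  classical
  set p := ∑ y ∈ s, prodWeight w y with hp
  set k : ℝ := (Fintype.card κ : ℝ)
  have hk' : 0 < k := by simpa [k] using hk
  set a : ι → ℝ := fun i => (∑ y ∈ s, prodWeight w y * blockSum (χ i) y) / p with ha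
  have hp1 : p ≤ 1 := by
    rw [← sum_prodWeight (κ := κ) h.sum_one]
    exact sum_le_sum_of_subset_of_nonneg (subset_univ _)
      fun y _ _ => prodWeight_nonneg h.nonneg y
  have hlog : 0 ≤ -log p := by linarith [log_nonpos hs.le hp1]
  set A := √((∑ i, a i ^ 2) / k) with hA
  change lam * A ≤ -log p + lam ^ 2
  have hA2 : A ^ 2 = (∑ i, a i ^ 2) / k :=
    sq_sqrt (div_nonneg (sum_nonneg fun _ _ => sq_nonneg _) hk'.le)
  -- The tilt `c` below divides by `A`, so `A = 0` is treated apart.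
  rcases (sqrt_nonneg ((∑ i, a i ^ 2) / k)).eq_or_lt with h0 | h0
  · rw [hA, ← h0]; nlinarith [sq_nonneg lam]
  change 0 < A at h0
  have hsum : ∑ i, a i ^ 2 = A ^ 2 * k := by rw [hA2]; field_simp
  -- The tilt points along the conditional mean vector and is scaled so that it pairs with it to
  -- `lam * A`.
  set c : ι → ℝ := fun i => lam / (A * k) * a i with hc
  have hc2 : ∑ i, c i ^ 2 = lam ^ 2 / k := by
    simp_rw [hc, mul_pow]
    rw [← mul_sum, hsum]; field_simp
  have hca : ∑ i, c i * a i = lam * A := by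
    have : ∀ i, c i * a i = lam / (A * k) * a i ^ 2 := fun i => by simp only [hc]; ring
    simp_rw [this]
    rw [← mul_sum, hsum]; field_simp
  have hexp := h.sum_prodWeight_exp_le (κ := κ) c (by
    rw [hc2, div_mul_eq_mul_div, div_le_one hk']; exact hlam)
  rw [hc2, mul_div_cancel₀ _ hk'.ne'] at hexp
  have hmean : ∑ y ∈ s, prodWeight w y * ∑ i, c i * blockSum (χ i) y = p * (lam * A) := by
    rw [← hca]
    simp_rw [mul_sum]
    rw [sum_comm]
    refine sum_congr rfl fun i _ => ?_
    have : ∀ y : κ → Ω, prodWeight w y * (c i * blockSum (χ i) y) =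
      c i * (prodWeight w y * blockSum (χ i) y) := fun y => by ring
    simp_rw [this]
    rw [← mul_sum, ha]; field_simp
  -- Jensen on the event, in the form of the tangent line of `exp` at `lam * A`; the exponential
  -- moment over the event is at most the one over the whole space.
  have hjensen : p * exp (lam * A) ≤ exp (lam ^ 2) := by
    refine le_trans ?_ hexp
    refine le_trans ?_ (sum_le_sum_of_subset_of_nonneg (subset_univ s)
      fun y _ _ => mul_nonneg (prodWeight_nonneg h.nonneg y) (exp_pos _).le)
    calc p * exp (lam * A)
        = ∑ y ∈ s, prodWeight w y * (exp (lam * A) *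
            (1 + (∑ i, c i * blockSum (χ i) y - lam * A))) := by
          have : ∀ y : κ → Ω, prodWeight w y * (exp (lam * A) *
            (1 + (∑ i, c i * blockSum (χ i) y - lam * A))) =
            exp (lam * A) * (1 - lam * A) * prodWeight w y +
            exp (lam * A) * (prodWeight w y * ∑ i, c i * blockSum (χ i) y) := fun y => by ring
          simp_rw [this]
          rw [sum_add_distrib, ← mul_sum, ← mul_sum, hmean, ← hp]; ring
      _ ≤ _ := by
          refine sum_le_sum fun y _ =>
            mul_le_mul_of_nonneg_left ?_ (prodWeight_nonneg h.nonneg y)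
          have h1 := add_one_le_exp (∑ i, c i * blockSum (χ i) y - lam * A)
          have h2 := mul_le_mul_of_nonneg_left h1 (exp_pos (lam * A)).le
          rw [← exp_add, add_sub_cancel] at h2
          linarith
  have h3 := log_le_log (by positivity) hjensen
  rw [log_exp, log_mul hs.ne' (exp_pos _).ne', log_exp] at h3
  linarith

/-- A function with `2 ^ b` values carries at most `O(b k)` second moment about the block sums
of all the signs together. -/
theorem sum_condEnergy_blockSum_le (h : OrthoSigns w χ) {b : ℕ} (hb : 1 ≤ b)
    (hk : 0 < Fintype.card κ) (hbk : 2 * b * Fintype.card ι ≤ Fintype.card κ)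
    (f : (κ → Ω) → P) (hf : (Set.range f).ncard ≤ 2 ^ b) :
    ∑ i, condEnergy (prodWeight w) f (blockSum (χ i)) ≤ 24 * b * Fintype.card κ := by
  classical
  set k : ℝ := (Fintype.card κ : ℝ) with hkdef
  have hk' : 0 < k := by simpa [k] using hk
  have hb' : (1 : ℝ) ≤ b := by exact_mod_cast hb
  have hbk' : 2 * (b : ℝ) * Fintype.card ι ≤ k := by
    rw [hkdef]; exact_mod_cast hbk
  have hW := fun y : κ → Ω => prodWeight_nonneg h.nonneg y
  unfold condEnergy
  rw [sum_comm]
  have key : ∀ q ∈ univ.image f,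
      ∑ i, (∑ y with f y = q, prodWeight w y * blockSum (χ i) y) ^ 2 /
        ∑ y with f y = q, prodWeight w y ≤
      k * (8 * b * (∑ y with f y = q, prodWeight w y) + 16 * exp (-b)) := by
    intro q _
    set s : Finset (κ → Ω) := {y | f y = q} with hs
    rcases (sum_nonneg fun y (_ : y ∈ s) => hW y).eq_or_lt with h0 | h0
    · rw [← h0]; simp; positivity
    have hp1 : ∑ y ∈ s, prodWeight w y ≤ 1 := by
      rw [← sum_prodWeight (κ := κ) h.sum_one]
      exact sum_le_sum_of_subset_of_nonneg (subset_univ _) fun y _ _ => hW y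
    have hn : (Fintype.card ι : ℝ) ≤ 2 * b * Fintype.card ι := by
      have : (0 : ℝ) ≤ Fintype.card ι := by positivity
      nlinarith
    have h1 := h.mul_norm_le hk s h0 (lam := 1) (by linarith)
    have h2 := h.mul_norm_le hk s h0 (lam := √(2 * b)) (by
      rw [sq_sqrt (by positivity)]; exact hbk')
    rw [sq_sqrt (by positivity)] at h2
    rw [one_mul, one_pow] at h1
    have h3 := mul_sq_le_of_linear_bounds h0 hp1 (sqrt_nonneg _) hb' h1 h2
    rw [sq_sqrt (div_nonneg (sum_nonneg fun _ _ => sq_nonneg _) hk'.le)] at h3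
    have h4 := mul_le_mul_of_nonneg_left h3 hk'.le
    refine le_trans (le_of_eq ?_) h4
    rw [mul_left_comm, mul_div_cancel₀ _ hk'.ne', mul_sum]
    refine sum_congr rfl fun i _ => ?_
    field_simp
  have hzero : ∀ q ∉ univ.image f,
      ∑ i, (∑ y with f y = q, prodWeight w y * blockSum (χ i) y) ^ 2 /
        ∑ y with f y = q, prodWeight w y = 0 := by
    intro q hq
    have : ({y | f y = q} : Finset (κ → Ω)) = ∅ := by
      ext y; simp; rintro rfl; exact hq (mem_image_of_mem _ (mem_univ y))
    simp [this]
  rw [← sum_subset (subset_univ (univ.image f)) fun q _ hq => hzero q hq]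
  refine le_trans (sum_le_sum key) ?_
  rw [← mul_sum, sum_add_distrib, ← mul_sum, sum_const, nsmul_eq_mul]
  have h1 : ∑ q ∈ univ.image f, ∑ y with f y = q, prodWeight w y = 1 := by
    rw [sum_fiberwise_of_maps_to (fun y _ => mem_image_of_mem f (mem_univ y)),
      sum_prodWeight h.sum_one]
  -- At most `2 ^ b ≤ exp b` values occur, so the rare-event terms sum to a constant.
  have h2 : ((univ.image f).card : ℝ) * (16 * exp (-b)) ≤ 16 := by
    have hcard : ((univ.image f).card : ℝ) ≤ 2 ^ b := by
      have : (univ.image f).card = (Set.range f).ncard := by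
        rw [← Set.ncard_coe_finset]; simp
      rw [this]; exact_mod_cast hf
    have h3 : (2 : ℝ) ^ b ≤ exp b := by
      rw [← exp_one_pow]
      exact pow_le_pow_left₀ (by norm_num) (by linarith [exp_one_gt_d9]) _
    have h4 : ((univ.image f).card : ℝ) * exp (-b) ≤ exp b * exp (-b) :=
      mul_le_mul_of_nonneg_right (hcard.trans h3) (exp_pos _).le
    rw [← exp_add, add_neg_cancel, exp_zero] at h4
    linarith
  rw [h1]
  nlinarith

end OrthoSigns

/-! ### Protocols with product structure -/

section Rectangles

open scoped Classical

variable {J P Y : Type*} [Fintype J] [DecidableEq J] [Fintype Y]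

/-- The mass that the weights `V` give to the set of inputs of player `j` that are compatible with
the transcript `p`. -/
def rectMass (R : J → P → Y → Prop) (V : Y → ℝ) (j : J) (p : P) : ℝ := ∑ y with R j p y, V y

theorem prod_sum_filter (R : J → Y → Prop) (V : J → Y → ℝ) :
    ∏ j, ∑ y with R j y, V j y =
      ∑ y : J → Y, if ∀ j, R j (y j) then ∏ j, V j (y j) else 0 := by
  simp_rw [sum_filter]
  rw [Fintype.prod_sum]
  refine sum_congr rfl fun y _ => ?_
  split_ifs with h
  · exact prod_congr rfl fun j _ => if_pos (h j)
  · push Not at h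
    obtain ⟨j, hj⟩ := h
    exact prod_eq_zero (mem_univ j) (if_neg hj)

/-- The relative change of the probability of the transcript `p` when the input of player `j` gets
the density `G`. -/
def rectShift (R : J → P → Y → Prop) (W G : Y → ℝ) (j : J) (p : P) : ℝ :=
  rectMass R (fun y => W y * (G y - 1)) j p / rectMass R W j p

/-- Multiplying by the shift only changes the weight of player `j`, so the sum over transcripts
still factorizes. If player `j` has mass zero, the signed mass vanishes too, and division by zero
does no harm. -/
theorem prod_rectMass_mul_rectShift (R : J → P → Y → Prop) {W : Y → ℝ} (hW : ∀ y, 0 ≤ W y) (G : Y → ℝ) (j : J) (p : P) :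
    (∏ i, rectMass R W i p) * rectShift R W G j p =
      ∏ i, rectMass R (if i = j then fun y => W y * (G y - 1) else W) i p := by
  rw [← mul_prod_erase univ _ (mem_univ j), ← mul_prod_erase univ
    (fun i => rectMass R (if i = j then fun y => W y * (G y - 1) else W) i p) (mem_univ j)]
  have h1 : ∏ i ∈ univ.erase j, rectMass R (if i = j then fun y => W y * (G y - 1) else W) i p =
      ∏ i ∈ univ.erase j, rectMass R W i p :=
    prod_congr rfl fun i hi => by rw [if_neg (ne_of_mem_erase hi)]
  rw [h1, if_pos rfl, rectShift]
  by_cases h0 : rectMass R W j p = 0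
  · have h2 : rectMass R (fun y => W y * (G y - 1)) j p = 0 := by
      unfold rectMass at h0 ⊢
      rw [sum_eq_zero_iff_of_nonneg fun y _ => hW y] at h0
      exact sum_eq_zero fun y hy => by rw [h0 y hy, zero_mul]
    rw [h0, h2]; simp
  · field_simp

variable [Fintype P] {R : J → P → Y → Prop} {tr : (J → Y) → P}

/-- The rectangle property: the inputs producing a given transcript form a product set, so its
weight is a product over players, even for signed weights. -/
theorem sum_mul_prod_rectMass (htr : ∀ y p, tr y = p ↔ ∀ j, R j p (y j)) (V : J → Y → ℝ)
    (φ : P → ℝ) :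
    ∑ p, φ p * ∏ j, rectMass R (V j) j p = ∑ y : J → Y, φ (tr y) * ∏ j, V j (y j) := by
  simp_rw [rectMass, prod_sum_filter (fun j => R j _), ← htr, mul_sum]
  rw [sum_comm]
  simp

theorem sum_prod_rectMass (htr : ∀ y p, tr y = p ↔ ∀ j, R j p (y j)) (V : J → Y → ℝ) :
    ∑ p, ∏ j, rectMass R (V j) j p = ∏ j, ∑ y, V j y := by
  have := sum_mul_prod_rectMass htr V (fun _ => 1)
  simp only [one_mul] at this
  rw [this, Fintype.prod_sum]

/-- The squared shifts of all players together, for a transcript of the null distribution. -/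
def totalEnergy (R : J → P → Y → Prop) (W G : Y → ℝ) : ℝ :=
  ∑ j, ∑ p, (∏ i, rectMass R W i p) * rectShift R W G j p ^ 2

theorem sum_rectShift (htr : ∀ y p, tr y = p ↔ ∀ j, R j p (y j)) {W : Y → ℝ}
    (hW : ∀ y, 0 ≤ W y) (hW1 : ∑ y, W y = 1) (G : Y → ℝ) (j : J) :
    ∑ p, (∏ i, rectMass R W i p) * rectShift R W G j p = ∑ y, W y * G y - 1 := by
  simp_rw [prod_rectMass_mul_rectShift R hW]
  rw [sum_prod_rectMass htr fun i => if i = j then fun y => W y * (G y - 1) else W,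
    prod_eq_single j]
  · simp [mul_sub, sum_sub_distrib, hW1]
  · intro i _ hi
    simp [hi, hW1]
  · simp

/-- Once the other inputs are fixed, the transcript depends on the block of player `j` alone, and
the shift is the conditional mean of `G - 1` given it. -/
theorem sum_rectShift_sq_le (htr : ∀ y p, tr y = p ↔ ∀ j, R j p (y j)) {W : Y → ℝ}
    (hW : ∀ y, 0 ≤ W y) (hW1 : ∑ y, W y = 1) (G : Y → ℝ) (j : J) :
    ∑ p, (∏ i, rectMass R W i p) * rectShift R W G j p ^ 2 ≤
      ∑ y : J → Y, prodWeight W y *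
        condEnergy W (fun y' => tr (Function.update y j y')) (fun y' => G y' - 1) := by
  set ψ : P → ℝ := fun p => rectMass R (fun y => W y * (G y - 1)) j p ^ 2 / rectMass R W j p
    with hψ
  have h1 : ∀ p, (∏ i, rectMass R W i p) * rectShift R W G j p ^ 2 =
      ∑ y : J → Y, if ∀ i, i ≠ j → R i p (y i) then prodWeight W y * ψ p else 0 := by
    intro p
    -- The product over the other players becomes a sum over all inputs, with the coordinate `j`
    -- unconstrained and of total weight one.
    have h2 : ∏ i ∈ univ.erase j, rectMass R W i p =
        ∑ y : J → Y, if ∀ i, i ≠ j → R i p (y i) then prodWeight W y else 0 := by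
      have h3 := prod_sum_filter (fun i y => i ≠ j → R i p y) (fun _ => W)
      have h5 : (∑ y : J → Y, if ∀ i, i ≠ j → R i p (y i) then prodWeight W y else 0) =
          ∏ i, ∑ y with (i ≠ j → R i p y), W y := by
        unfold prodWeight
        convert h3.symm
      rw [h5, ← mul_prod_erase univ _ (mem_univ j)]
      have h4 : ∑ y with (j ≠ j → R j p y), W y = 1 := by simpa using hW1
      rw [h4, one_mul]
      refine prod_congr rfl fun i hi => ?_
      have := ne_of_mem_erase hi
      simp [rectMass, this]
    rw [← mul_prod_erase univ _ (mem_univ j), h2, mul_sum, sum_mul]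
    refine sum_congr rfl fun y _ => ?_
    split_ifs
    · rw [hψ, rectShift]
      by_cases h0 : rectMass R W j p = 0
      · simp [h0]
      · field_simp
    · simp
  simp_rw [h1]
  rw [sum_comm]
  refine sum_le_sum fun y _ => ?_
  unfold condEnergy
  rw [mul_sum]
  refine sum_le_sum fun p _ => ?_
  have hnn : 0 ≤ (∑ y' with tr (Function.update y j y') = p, W y' * (G y' - 1)) ^ 2 /
      ∑ y' with tr (Function.update y j y') = p, W y' :=
    div_nonneg (sq_nonneg _) (sum_nonneg fun y _ => hW y)
  split_ifs with h
  · have hset : ∀ y', R j p y' ↔ tr (Function.update y j y') = p := by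
      intro y'
      rw [htr]
      constructor
      · intro hj i
        by_cases hi : i = j
        · subst hi; simpa using hj
        · simpa [hi] using h i hi
      · intro hall
        simpa using hall j
    rw [hψ]
    simp only [rectMass, hset]
    exact le_rfl
  · exact mul_nonneg (prodWeight_nonneg hW y) hnn

theorem totalEnergy_le (htr : ∀ y p, tr y = p ↔ ∀ j, R j p (y j)) {W : Y → ℝ}
    (hW : ∀ y, 0 ≤ W y) (hW1 : ∑ y, W y = 1) (G : Y → ℝ) :
    totalEnergy R W G ≤ ∑ j, ∑ y : J → Y, prodWeight W y *
        condEnergy W (fun y' => tr (Function.update y j y')) (fun y' => G y' - 1) :=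
  sum_le_sum fun j _ => sum_rectShift_sq_le htr hW hW1 G j

/-- The tangent line of `log` at `c`. The point of tangency stays free so that it can differ on and
off an event. -/
theorem mul_log_div_le {a b c : ℝ} (ha : 0 < a) (hb : 0 < b) (hc : 0 < c) :
    a * log (b / a) ≤ b / c + a * (log c - 1) := by
  have h := log_le_sub_one_of_pos (show 0 < b / a / c by positivity)
  rw [log_div (by positivity) hc.ne'] at h
  have h2 : b / c = a * (b / a / c) := by field_simp
  rw [h2, ← mul_add]
  exact mul_le_mul_of_nonneg_left (by linarith) ha.le

/-- The relative entropy between the null distribution of the transcript and its distribution when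
all inputs have the density `G ≥ 1 / 2` is additive over the players. If an event is likely under
the second distribution, then it is not unlikely under the first one, or the energy is large. -/
theorem le_totalEnergy (htr : ∀ y p, tr y = p ↔ ∀ j, R j p (y j)) {W G : Y → ℝ}
    (hW : ∀ y, 0 ≤ W y) (hW1 : ∑ y, W y = 1) (hG : ∀ y, 1 / 2 ≤ G y)
    (hG1 : 1 ≤ ∑ y, W y * G y) (hGJ : (∑ y, W y * G y) ^ Fintype.card J ≤ 1.1)
    (E : P → Prop)
    (hE : 2 / 3 ≤ ∑ y : J → Y, (if E (tr y) then 1 else 0) * ∏ j, W (y j) * G (y j)) :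
    0.4 ≤ totalEnergy R W G +
      1.7 * ∑ y : J → Y, (if E (tr y) then 1 else 0) * prodWeight W y := by
  set Q : P → ℝ := fun p => ∏ j, rectMass R W j p with hQ
  set Q' : P → ℝ := fun p => ∏ j, rectMass R (fun y => W y * G y) j p with hQ'
  have hWG : ∀ y, 0 ≤ W y * G y := fun y => mul_nonneg (hW y) (by linarith [hG y])
  have hq0 : ∀ j p, 0 ≤ rectMass R W j p := fun j p => sum_nonneg fun y _ => hW y
  have hq0' : ∀ j p, 0 ≤ rectMass R (fun y => W y * G y) j p :=
    fun j p => sum_nonneg fun y _ => hWG y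
  have hQ0 : ∀ p, 0 ≤ Q p := fun p => prod_nonneg fun j _ => hq0 j p
  have hQ0' : ∀ p, 0 ≤ Q' p := fun p => prod_nonneg fun j _ => hq0' j p
  have hsumQ : ∑ p, Q p = 1 := by
    rw [hQ, sum_prod_rectMass htr fun _ => W]; simp [hW1]
  have hsumQ' : ∑ p, Q' p = (∑ y, W y * G y) ^ Fintype.card J := by
    rw [hQ', sum_prod_rectMass htr fun _ y => W y * G y]; simp
  have hEQ : ∑ p, (if E p then 1 else 0) * Q p =
      ∑ y : J → Y, (if E (tr y) then 1 else 0) * prodWeight W y :=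
    sum_mul_prod_rectMass htr (fun _ => W) fun p => if E p then 1 else 0
  have hEQ' : ∑ p, (if E p then 1 else 0) * Q' p =
      ∑ y : J → Y, (if E (tr y) then 1 else 0) * ∏ j, W (y j) * G (y j) :=
    sum_mul_prod_rectMass htr (fun _ y => W y * G y) fun p => if E p then 1 else 0
  rw [← hEQ'] at hE
  rw [← hEQ]
  have hpt : ∀ p, ∑ j, (Q p * rectShift R W G j p - Q p * rectShift R W G j p ^ 2) ≤
      (if E p then 1 else 0) * (Q' p / exp 1) +
      (1 - if E p then 1 else 0) * (2 * Q' p - Q p * (1 + log 2)) := by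
    intro p
    rcases (hQ0 p).eq_or_lt with h0 | h0
    · rw [← h0]
      have := hQ0' p
      split_ifs
      · simp; positivity
      · simp; positivity
    have hqpos : ∀ j, 0 < rectMass R W j p := fun j =>
      lt_of_le_of_ne (hq0 j p) fun h => h0.ne' (prod_eq_zero (mem_univ j) h.symm)
    have hhalf : ∀ j, rectMass R W j p / 2 ≤ rectMass R (fun y => W y * G y) j p := by
      intro j
      unfold rectMass
      rw [sum_div]
      refine sum_le_sum fun y _ => ?_
      have := mul_le_mul_of_nonneg_left (hG y) (hW y)
      linarith
    have hqpos' : ∀ j, 0 < rectMass R (fun y => W y * G y) j p := fun j =>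
      lt_of_lt_of_le (half_pos (hqpos j)) (hhalf j)
    have hshift : ∀ j, 1 + rectShift R W G j p =
        rectMass R (fun y => W y * G y) j p / rectMass R W j p := by
      intro j
      have : rectMass R (fun y => W y * (G y - 1)) j p =
          rectMass R (fun y => W y * G y) j p - rectMass R W j p := by
        simp [rectMass, mul_sub, sum_sub_distrib]
      rw [rectShift, this, sub_div, div_self (hqpos j).ne']
      ring
    have hpos' : 0 < Q' p := prod_pos fun j _ => hqpos' j
    have hlog : log (Q' p / Q p) = ∑ j, log (1 + rectShift R W G j p) := by
      simp_rw [hshift]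
      rw [hQ, hQ', ← prod_div_distrib, log_prod]
      intro j _
      exact (div_pos (hqpos' j) (hqpos j)).ne'
    have hle : ∑ j, (Q p * rectShift R W G j p - Q p * rectShift R W G j p ^ 2) ≤
        Q p * log (Q' p / Q p) := by
      rw [hlog, mul_sum]
      refine sum_le_sum fun j _ => ?_
      rw [← mul_sub]
      -- The lower bound `1/2` on `G` keeps every shift above `-1/2`, where the quadratic bound for
      -- `log` is valid.
      refine mul_le_mul_of_nonneg_left (sub_sq_le_log ?_) h0.le
      have : 1 / 2 ≤ 1 + rectShift R W G j p := by
        rw [hshift, le_div_iff₀ (hqpos j)]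
        linarith [hhalf j]
      linarith
    refine hle.trans ?_
    -- Tangent at `exp 1` on the event, where the `Q` term cancels, and at `1/2` off it.
    split_ifs
    · have := mul_log_div_le h0 hpos' (exp_pos 1)
      rw [log_exp] at this
      linarith
    · have := mul_log_div_le h0 hpos' (show (0 : ℝ) < 1 / 2 by norm_num)
      rw [one_div, log_inv, div_inv_eq_mul] at this
      linarith
  have hsum := sum_le_sum fun p (_ : p ∈ univ) => hpt p
  have hleft : ∑ p, ∑ j, (Q p * rectShift R W G j p - Q p * rectShift R W G j p ^ 2) =
      Fintype.card J * (∑ y, W y * G y - 1) - totalEnergy R W G := by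
    rw [sum_comm]
    simp_rw [sum_sub_distrib]
    congr 1
    rw [sum_congr rfl fun j _ => sum_rectShift htr hW hW1 G j]
    rw [sum_const, nsmul_eq_mul, card_univ]
  rw [hleft] at hsum
  set α := ∑ p, (if E p then 1 else 0) * Q p with hα
  set β := ∑ p, (if E p then 1 else 0) * Q' p with hβ
  have hright : ∑ p, ((if E p then 1 else 0) * (Q' p / exp 1) +
      (1 - if E p then 1 else 0) * (2 * Q' p - Q p * (1 + log 2))) =
      β / exp 1 + 2 * (∑ p, Q' p - β) - (1 - α) * (1 + log 2) := by
    have h1 : (1 - α) = ∑ p, (Q p - (if E p then 1 else 0) * Q p) := by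
      rw [sum_sub_distrib, hsumQ]
    rw [h1, hβ, sum_div, ← sum_sub_distrib, mul_sum, sum_mul, ← sum_add_distrib,
      ← sum_sub_distrib]
    exact sum_congr rfl fun p _ => by ring
  rw [hright, hsumQ'] at hsum
  have hJ : 0 ≤ (Fintype.card J : ℝ) * (∑ y, W y * G y - 1) :=
    mul_nonneg (by positivity) (by linarith)
  have hα1 : α ≤ 1 := by
    rw [hα]
    refine (sum_le_sum fun p _ => ?_).trans_eq hsumQ
    have := hQ0 p
    split_ifs <;> linarith
  have hlog2 := log_two_gt_d9
  have hβ : β / exp 1 ≤ β * 0.4 := by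
    rw [div_eq_mul_inv]
    refine mul_le_mul_of_nonneg_left ?_ (by linarith)
    rw [inv_le_comm₀ (exp_pos 1) (by norm_num)]
    linarith [exp_one_gt_d9]
  have h69 : (1 - α) * 1.69 ≤ (1 - α) * (1 + log 2) :=
    mul_le_mul_of_nonneg_left (by linarith) (by linarith)
  have hα0 : 0 ≤ α := by
    refine sum_nonneg fun p _ => mul_nonneg ?_ (hQ0 p)
    split_ifs <;> norm_num
  -- With `β ≥ 2/3` and total planted mass at most `1.1`, the energy is at least `1.6 * β - 2.2 +
  -- 1.69 * (1 - α)`, which exceeds `0.55 - 1.69 * α`.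
  linarith

end Rectangles

/-! ### Sequential protocols -/

section Sequential

variable {J Y M : Type*} {n : ℕ}

/-- The memory contents during a protocol in which player `player τ` applies `F τ` at step `τ`. -/
def transcript (player : Fin n → J) (F : Fin n → Y → M → M) (init : M) (y : J → Y) :
    Fin (n + 1) → M :=
  fun i => Fin.induction (motive := fun _ => M) init (fun τ u => F τ (y (player τ)) u) i

/-- The transcript `p` is compatible with the input `y` of player `j`. -/
def Compatible (player : Fin n → J) (F : Fin n → Y → M → M) (init : M) (j : J)
    (p : Fin (n + 1) → M) (y : Y) : Prop :=
  p 0 = init ∧ ∀ τ, player τ = j → p τ.succ = F τ y (p τ.castSucc)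

variable {player : Fin n → J} {F : Fin n → Y → M → M} {init : M}

theorem transcript_zero (y : J → Y) : transcript player F init y 0 = init := rfl

theorem transcript_succ (y : J → Y) (τ : Fin n) :
    transcript player F init y τ.succ =
      F τ (y (player τ)) (transcript player F init y τ.castSucc) :=
  Fin.induction_succ _ _ _

/-- The initial condition is part of every player's compatibility; some player must exist for it to
be imposed at all. -/
theorem transcript_eq_iff [Nonempty J] (y : J → Y) (p : Fin (n + 1) → M) :
    transcript player F init y = p ↔ ∀ j, Compatible player F init j p (y j) := by
  constructor
  · rintro rfl j
    refine ⟨transcript_zero y, ?_⟩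
    rintro τ rfl
    exact transcript_succ y τ
  · intro h
    ext i
    induction i using Fin.induction with
    | zero => rw [transcript_zero, (h (Classical.arbitrary J)).1]
    | succ τ ih => rw [transcript_succ, ih, ← (h (player τ)).2 τ rfl]

theorem transcript_last (player : Fin n → J) (F : Fin n → Y → M → M) (init : M) (y : J → Y) :
    transcript player F init y (Fin.last n) =
      Fin.foldl n (fun u τ => F τ (y (player τ)) u) init := by
  have key : ∀ (r : ℕ) (hr : r ≤ n), transcript player F init y ⟨r, by omega⟩ =
      Fin.foldl r (fun u τ => F (Fin.castLE hr τ) (y (player (Fin.castLE hr τ))) u) init := by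
    intro r
    induction r with
    | zero => intro _; simp; rfl
    | succ r ih =>
      intro hr
      rw [Fin.foldl_succ_last]
      have h1 := transcript_succ (player := player) (F := F) (init := init) y ⟨r, hr⟩
      refine Eq.trans h1 ?_
      congr 1
      exact ih (by omega)
  exact key n le_rfl

/-- Entries written by other players follow from the preceding entry, so the entries at the steps of
`j` determine the transcript. -/
theorem ncard_range_transcript_le [Fintype M] [DecidableEq J] (y : J → Y) (j : J) :
    (Set.range fun y' => transcript player F init (Function.update y j y')).ncard ≤
      Fintype.card M ^ Fintype.card {τ // player τ = j} := by
  classical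
  let col : (Fin (n + 1) → M) → ({τ // player τ = j} → M) := fun p τ => p τ.1.succ
  have hinj : Set.InjOn col
      (Set.range fun y' => transcript player F init (Function.update y j y')) := by
    rintro _ ⟨a, rfl⟩ _ ⟨b, rfl⟩ hab
    funext i
    induction i using Fin.induction with
    | zero => rfl
    | succ τ ih =>
      by_cases hτ : player τ = j
      · exact congrFun hab ⟨τ, hτ⟩
      · simp only at ih ⊢
        rw [transcript_succ, transcript_succ, ih, Function.update_of_ne hτ,
          Function.update_of_ne hτ]
  rw [← hinj.ncard_image]
  refine (Set.ncard_le_ncard (Set.subset_univ _) Set.finite_univ).trans_eq ?_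
  rw [Set.ncard_univ, Nat.card_eq_fintype_card, Fintype.card_fun]

end Sequential

/-! ### Nested folds -/

theorem foldl_mul_nat {α : Type*} (m k : ℕ) (g : α → ℕ → α) (a : α) :
    Fin.foldl (m * k) (fun u i => g u i) a =
      Fin.foldl m (fun u b => Fin.foldl k (fun v i => g v (b * k + i)) u) a := by
  induction m with
  | zero => rw [Fin.foldl_congr (Nat.zero_mul k)]; simp
  | succ m ih =>
    rw [Fin.foldl_congr (Nat.succ_mul m k), Fin.foldl_add, Fin.foldl_succ_last]
    simp only [Fin.val_cast, Fin.val_natAdd, Fin.val_castLE, Fin.val_last, Fin.val_castSucc,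
      ih]

theorem foldl_mul {α : Type*} (m k : ℕ) (f : α → Fin (m * k) → α) (a : α) :
    Fin.foldl (m * k) f a =
      Fin.foldl m (fun u b => Fin.foldl k (fun v i => f v (finProdFinEquiv (b, i))) u) a := by
  have h := foldl_mul_nat m k (fun u i => if h : i < m * k then f u ⟨i, h⟩ else u) a
  simp only [Fin.is_lt, dite_true, Fin.eta] at h
  rw [h]
  congr 1
  funext u b
  congr 1
  funext v i
  have : (b : ℕ) * k + i = (finProdFinEquiv (b, i) : Fin (m * k)) := by
    simp [finProdFinEquiv]; ring
  simp only [this, Fin.is_lt, dite_true, Fin.eta]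

theorem foldl_pad {α : Type*} {t N : ℕ} (htN : t ≤ N) (f : α → Fin t → α) (a : α) :
    Fin.foldl N (fun u i => if h : (i : ℕ) < t then f u ⟨i, h⟩ else u) a = Fin.foldl t f a := by
  obtain ⟨r, rfl⟩ := Nat.exists_eq_add_of_le htN
  rw [Fin.foldl_add]
  have : ∀ (r : ℕ) (b : α), Fin.foldl r (fun u _ => u) b = b := by
    intro r
    induction r with
    | zero => simp
    | succ r ih => intro b; rw [Fin.foldl_succ]; exact ih b
  simp [this]

/-! ### Grouping the data into blocks -/

/-- The position in the grid of blocks of the data point `i`. -/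
def blockIndex {t m k : ℕ} (htmk : t ≤ m * k) (i : Fin t) : Fin m × Fin k :=
  finProdFinEquiv.symm (Fin.castLE htmk i)

theorem blockIndex_injective {t m k : ℕ} (htmk : t ≤ m * k) :
    Function.Injective (blockIndex htmk) :=
  finProdFinEquiv.symm.injective.comp (Fin.castLE_injective htmk)

/-- The first `t` data points in a family of blocks. -/
def unblock {Ω : Type*} {t m k : ℕ} (htmk : t ≤ m * k) (y : Fin m → Fin k → Ω) (i : Fin t) : Ω :=
  y (blockIndex htmk i).1 (blockIndex htmk i).2

/-- Coordinates outside the range of `e` integrate to one. This disposes of the padding in the last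
blocks. -/
theorem sum_prod_comp_injective {C T Ω : Type*} [Fintype C] [DecidableEq C] [Fintype T]
    [DecidableEq T] [Fintype Ω] {v : Ω → ℝ} (hv : ∑ a, v a = 1) {e : T → C}
    (he : Function.Injective e) (φ : (T → Ω) → ℝ) :
    ∑ z : C → Ω, (∏ c, v (z c)) * φ (z ∘ e) = ∑ x : T → Ω, (∏ i, v (x i)) * φ x := by
  classical
  have h1 : ∀ z : C → Ω, (∏ c, v (z c)) * φ (z ∘ e) =
      ∑ x : T → Ω, φ x * ∏ c, (if ∀ i, e i = c → z c = x i then v (z c) else 0) := by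
    intro z
    rw [sum_eq_single (z ∘ e)]
    · rw [mul_comm]
      congr 1
      refine prod_congr rfl fun c _ => ?_
      rw [if_pos]
      rintro i rfl
      rfl
    · intro x _ hx
      obtain ⟨i, hi⟩ := Function.ne_iff.mp hx
      rw [prod_eq_zero (mem_univ (e i)), mul_zero]
      rw [if_neg]
      intro h
      exact hi (h i rfl).symm
    · simp
  simp_rw [h1]
  rw [sum_comm]
  refine sum_congr rfl fun x _ => ?_
  rw [← mul_sum, mul_comm]
  congr 1
  rw [← Fintype.prod_sum (fun c a => if ∀ i, e i = c → a = x i then v a else 0)]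
  symm
  refine Fintype.prod_of_injective e he _ _ ?_ ?_
  · intro c hc
    rw [← hv]
    refine sum_congr rfl fun a _ => if_pos ?_
    intro i hi
    exact absurd ⟨i, hi⟩ hc
  · intro i
    have : ∀ a, (∀ i', e i' = e i → a = x i') ↔ a = x i := by
      intro a
      constructor
      · intro h; exact h i rfl
      · intro h i' hi'; rw [he hi']; exact h
    simp [this]

theorem sum_prod_unblock {Ω : Type*} [Fintype Ω] {t m k : ℕ} (htmk : t ≤ m * k) {v : Ω → ℝ}
    (hv : ∑ a, v a = 1) (φ : (Fin t → Ω) → ℝ) :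
    ∑ y : Fin m → Fin k → Ω, (∏ b, ∏ i, v (y b i)) * φ (unblock htmk y) =
      ∑ x : Fin t → Ω, (∏ i, v (x i)) * φ x := by
  rw [← sum_prod_comp_injective hv (blockIndex_injective htmk) φ,
    ← (Equiv.curry (Fin m) (Fin k) Ω).sum_comp]
  refine sum_congr rfl fun z _ => ?_
  rw [Fintype.prod_prod_type]
  rfl

/-! ### Memory algorithms as block protocols -/

namespace MemoryAlgorithm

variable {Ω ι : Type*} {t s ℓ : ℕ}

/-- The update of the memory at step `τ` of the protocol in which the data set is divided into `m`
blocks of size `k`; positions beyond the data set are ignored. -/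
def blockUpdate (A : MemoryAlgorithm Ω t s ℓ ι) (m k : ℕ) (τ : Fin (ℓ * m)) (y : Fin k → Ω)
    (u : Memory s) : Memory s :=
  Fin.foldl k (fun v i => if h : (finProdFinEquiv (τ.modNat, i) : Fin (m * k)) < t then
    A.update τ.divNat ⟨_, h⟩ (y i) v else v) u

/-- The block read at step `τ`. -/
def blockPlayer (ℓ m : ℕ) (τ : Fin (ℓ * m)) : Fin m := τ.modNat

/-- The memory contents at the ends of all blocks in all passes. -/
def blockTranscript (A : MemoryAlgorithm Ω t s ℓ ι) (m k : ℕ) (y : Fin m → Fin k → Ω) :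
    Fin (ℓ * m + 1) → Memory s :=
  transcript (blockPlayer ℓ m) (A.blockUpdate m k) A.init y

theorem blockTranscript_last (A : MemoryAlgorithm Ω t s ℓ ι) {m k : ℕ} (htmk : t ≤ m * k)
    (y : Fin m → Fin k → Ω) :
    A.blockTranscript m k y (Fin.last _) = A.finalMemory (unblock htmk y) := by
  rw [blockTranscript, transcript_last, foldl_mul]
  unfold finalMemory
  congr 1
  funext u p
  unfold runPass
  rw [← foldl_pad htmk, foldl_mul]
  congr 1
  funext v b
  have h1 : (finProdFinEquiv (p, b)).modNat = b :=
    congrArg Prod.snd (finProdFinEquiv.symm_apply_apply (p, b))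
  have h2 : (finProdFinEquiv (p, b)).divNat = p :=
    congrArg Prod.fst (finProdFinEquiv.symm_apply_apply (p, b))
  unfold blockUpdate blockPlayer
  rw [h1, h2]
  congr 1
  funext v i
  split_ifs with h
  · have h3 : blockIndex htmk ⟨_, h⟩ = (b, i) := finProdFinEquiv.symm_apply_apply (b, i)
    simp only [unblock, h3]
  · rfl

theorem card_blockPlayer_le (ℓ m : ℕ) (j : Fin m) :
    Fintype.card {τ // blockPlayer ℓ m τ = j} ≤ ℓ := by
  have h : Function.Injective fun τ : {τ // blockPlayer ℓ m τ = j} => τ.1.divNat := by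
    rintro ⟨a, ha⟩ ⟨b, hb⟩ hab
    refine Subtype.ext (finProdFinEquiv.symm.injective ?_)
    exact Prod.ext hab (ha.trans hb.symm)
  simpa using Fintype.card_le_of_injective _ h

theorem ncard_range_blockTranscript_le (A : MemoryAlgorithm Ω t s ℓ ι) (m k : ℕ)
    (y : Fin m → Fin k → Ω) (j : Fin m) :
    (Set.range fun y' => A.blockTranscript m k (Function.update y j y')).ncard ≤
      2 ^ (s * ℓ) := by
  refine (ncard_range_transcript_le y j).trans ?_
  rw [show Fintype.card (Memory s) = 2 ^ s by simp [Memory], ← pow_mul]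
  exact Nat.pow_le_pow_right two_pos (Nat.mul_le_mul_left s (card_blockPlayer_le ℓ m j))

end MemoryAlgorithm

/-! ### The lower bound for orthonormal signs -/

theorem sum_mul_le_of_le {Y : Type*} [Fintype Y] {W F : Y → ℝ} {B : ℝ} (hW : ∀ y, 0 ≤ W y)
    (hW1 : ∑ y, W y = 1) (hF : ∀ y, F y ≤ B) : ∑ y, W y * F y ≤ B := by
  refine (sum_le_sum fun y _ => mul_le_mul_of_nonneg_left (hF y) (hW y)).trans_eq ?_
  rw [← sum_mul, hW1, one_mul]

/-- The likelihood ratio of a block, truncated from below at `1 / 2`. -/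
def truncLikelihood {κ Ω : Type*} [Fintype κ] (ρ : ℝ) (f : Ω → ℝ) (y : κ → Ω) : ℝ :=
  max (likelihood ρ f y) (1 / 2)

namespace OrthoSigns

variable {Ω ι κ P : Type*} [Fintype Ω] [Fintype κ]
  {w : Ω → ℝ} {χ : ι → Ω → ℝ} {ρ : ℝ}

theorem likelihood_nonneg (h : OrthoSigns w χ) (hρ0 : 0 ≤ ρ) (hρ1 : ρ ≤ 1) (i : ι) (y : κ → Ω) :
    0 ≤ likelihood ρ (χ i) y := by
  refine prod_nonneg fun j _ => ?_
  have := abs_le.mp (h.abs_eq_one i (y j)).le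
  nlinarith [this.1]

theorem truncLikelihood_sub_mem (h : OrthoSigns w χ) (hρ0 : 0 ≤ ρ) (hρ1 : ρ ≤ 1) (i : ι)
    (y : κ → Ω) :
    0 ≤ truncLikelihood ρ (χ i) y - likelihood ρ (χ i) y ∧
      truncLikelihood ρ (χ i) y - likelihood ρ (χ i) y ≤
        if likelihood ρ (χ i) y < 1 / 2 then 1 else 0 := by
  have h0 := h.likelihood_nonneg hρ0 hρ1 i y
  unfold truncLikelihood
  split_ifs with hlt
  · rw [max_eq_right hlt.le]; constructor <;> linarith
  · rw [max_eq_left (not_lt.mp hlt)]; simp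

variable [DecidableEq κ] [Fintype P]

theorem one_le_sum_truncLikelihood (h : OrthoSigns w χ) (i : ι) :
    1 ≤ ∑ y : κ → Ω, prodWeight w y * truncLikelihood ρ (χ i) y := by
  rw [← h.sum_likelihood (κ := κ) ρ i]
  exact sum_le_sum fun y _ => mul_le_mul_of_nonneg_left (le_max_left _ _)
    (prodWeight_nonneg h.nonneg y)

theorem sum_truncLikelihood_le (h : OrthoSigns w χ) (hρ0 : 0 ≤ ρ) (hρ1 : ρ ≤ 1) (i : ι) :
    ∑ y : κ → Ω, prodWeight w y * truncLikelihood ρ (χ i) y ≤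
      1 + ∑ y : κ → Ω, prodWeight w y * (if likelihood ρ (χ i) y < 1 / 2 then 1 else 0) := by
  refine le_of_le_of_eq (b := ∑ y : κ → Ω, (prodWeight w y * likelihood ρ (χ i) y +
    prodWeight w y * (if likelihood ρ (χ i) y < 1 / 2 then 1 else 0))) ?_
    (by rw [sum_add_distrib, h.sum_likelihood])
  refine sum_le_sum fun y _ => ?_
  rw [← mul_add]
  refine mul_le_mul_of_nonneg_left ?_ (prodWeight_nonneg h.nonneg y)
  linarith [(h.truncLikelihood_sub_mem hρ0 hρ1 i y).2]

theorem sum_truncLikelihood_sub_sq_le (h : OrthoSigns w χ) (hρ0 : 0 ≤ ρ) (hρ1 : ρ ≤ 1) (i : ι) :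
    ∑ y : κ → Ω, prodWeight w y * (truncLikelihood ρ (χ i) y - likelihood ρ (χ i) y) ^ 2 ≤
      ∑ y : κ → Ω, prodWeight w y * (if likelihood ρ (χ i) y < 1 / 2 then 1 else 0) := by
  refine sum_le_sum fun y _ => ?_
  refine mul_le_mul_of_nonneg_left ?_ (prodWeight_nonneg h.nonneg y)
  obtain ⟨h0, h1⟩ := h.truncLikelihood_sub_mem hρ0 hρ1 i y
  split_ifs at h1 ⊢ <;> nlinarith

/-- Truncation at `1/2` only moves values towards `1`. This bound ignores the memory size; it serves
to show that `t * ρ ^ 2` cannot be tiny. -/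
theorem condEnergy_truncLikelihood_le (h : OrthoSigns w χ)
    (hx : Fintype.card κ * ρ ^ 2 ≤ 1) (f : (κ → Ω) → P) (i : ι) :
    condEnergy (prodWeight w) f (fun y => truncLikelihood ρ (χ i) y - 1) ≤
      2 * (Fintype.card κ * ρ ^ 2) := by
  refine (condEnergy_le (fun y => prodWeight_nonneg h.nonneg y) _ _).trans ?_
  have h1 : ∑ y : κ → Ω, prodWeight w y * (truncLikelihood ρ (χ i) y - 1) ^ 2 ≤
      ∑ y : κ → Ω, prodWeight w y * (likelihood ρ (χ i) y - 1) ^ 2 := by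
    refine sum_le_sum fun y _ => ?_
    refine mul_le_mul_of_nonneg_left ?_ (prodWeight_nonneg h.nonneg y)
    unfold truncLikelihood
    rcases le_total (likelihood ρ (χ i) y) (1 / 2) with h2 | h2
    · rw [max_eq_right h2]; nlinarith
    · rw [max_eq_left h2]
  refine h1.trans ?_
  rw [h.sum_likelihood_sub_one_sq]
  have h2 := pow_sub_one_sub_le hx
  have h3 : 0 ≤ (Fintype.card κ : ℝ) * ρ ^ 2 := by positivity
  nlinarith

theorem sum_condEnergy_truncLikelihood_le [Fintype ι] (h : OrthoSigns w χ) (hρ0 : 0 ≤ ρ)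
    (hρ1 : ρ ≤ 1) (hx : Fintype.card κ * ρ ^ 2 ≤ 1) {η : ℝ}
    (hη : ∀ i, ∑ y : κ → Ω, prodWeight w y * (if likelihood ρ (χ i) y < 1 / 2 then 1 else 0) ≤ η)
    {b : ℕ} (hb : 1 ≤ b) (hk : 0 < Fintype.card κ)
    (hbk : 2 * b * Fintype.card ι ≤ Fintype.card κ)
    (f : (κ → Ω) → P) (hf : (Set.range f).ncard ≤ 2 ^ b) :
    ∑ i, condEnergy (prodWeight w) f (fun y => truncLikelihood ρ (χ i) y - 1) ≤
      3 * (24 * b * (Fintype.card κ * ρ ^ 2) +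
        Fintype.card ι * ((Fintype.card κ * ρ ^ 2) ^ 2 + η)) := by
  have hW := fun y : κ → Ω => prodWeight_nonneg h.nonneg y
  have h1 : ∀ i, condEnergy (prodWeight w) f (fun y => truncLikelihood ρ (χ i) y - 1) ≤
      3 * (ρ ^ 2 * condEnergy (prodWeight w) f (blockSum (χ i)) +
        ((Fintype.card κ * ρ ^ 2) ^ 2 + η)) := by
    intro i
    -- Three parts: linear term, terms of higher degree, truncation defect. Only the first needs the
    -- limit on the number of values of `f`.
    have h2 := condEnergy_add_add_le hW f (fun y => ρ * blockSum (χ i) y)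
      (fun y => likelihood ρ (χ i) y - 1 - ρ * blockSum (χ i) y)
      (fun y => truncLikelihood ρ (χ i) y - likelihood ρ (χ i) y)
    have h3 : (fun y : κ → Ω => ρ * blockSum (χ i) y +
        (likelihood ρ (χ i) y - 1 - ρ * blockSum (χ i) y) +
        (truncLikelihood ρ (χ i) y - likelihood ρ (χ i) y)) =
        fun y => truncLikelihood ρ (χ i) y - 1 := by
      funext y; ring
    rw [h3, condEnergy_const_mul] at h2
    have h4 := condEnergy_le hW f (fun y => likelihood ρ (χ i) y - 1 - ρ * blockSum (χ i) y)
    rw [h.sum_likelihood_sub_linear_sq] at h4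
    have h5 := condEnergy_le hW f (fun y => truncLikelihood ρ (χ i) y - likelihood ρ (χ i) y)
    have h6 := h.sum_truncLikelihood_sub_sq_le (κ := κ) hρ0 hρ1 i
    have h7 := pow_sub_one_sub_le hx
    have h8 := hη i
    linarith
  refine (sum_le_sum fun i _ => h1 i).trans ?_
  rw [← mul_sum, sum_add_distrib, ← mul_sum, sum_const, nsmul_eq_mul, card_univ]
  have h9 := mul_le_mul_of_nonneg_left (h.sum_condEnergy_blockSum_le hb hk hbk f hf) (sq_nonneg ρ)
  linarith

end OrthoSigns

/-! ### Energy of an algorithm against its success probability -/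

namespace MemoryAlgorithm

open scoped Classical

variable {Ω ι : Type*} [Fintype Ω] {t s ℓ : ℕ} {w : Ω → ℝ} {χ : ι → Ω → ℝ} {ρ : ℝ}

/-- The energy of the block transcripts of an algorithm for the truncated likelihood ratio. -/
def energy (A : MemoryAlgorithm Ω t s ℓ ι) (m k : ℕ) (w : Ω → ℝ) (ρ : ℝ) (f : Ω → ℝ) : ℝ :=
  totalEnergy (Compatible (blockPlayer ℓ m) (A.blockUpdate m k) A.init)
    (prodWeight (κ := Fin k) w) (truncLikelihood ρ f)

theorem energy_le (h : OrthoSigns w χ) (A : MemoryAlgorithm Ω t s ℓ ι) {m k : ℕ} (hm : 0 < m)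
    (i : ι) :
    A.energy m k w ρ (χ i) ≤ ∑ j, ∑ y : Fin m → Fin k → Ω, prodWeight (prodWeight w) y *
      condEnergy (prodWeight w) (fun y' => A.blockTranscript m k (Function.update y j y'))
        (fun y' => truncLikelihood ρ (χ i) y' - 1) := by
  have : Nonempty (Fin m) := ⟨⟨0, hm⟩⟩
  have h1 := totalEnergy_le (P := Fin (ℓ * m + 1) → Memory s)
    (R := Compatible (blockPlayer ℓ m) (A.blockUpdate m k) A.init)
    (tr := A.blockTranscript m k) (fun y p => transcript_eq_iff y p)
    (W := prodWeight (κ := Fin k) w) (fun y => prodWeight_nonneg h.nonneg y)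
    (sum_prodWeight h.sum_one) (truncLikelihood ρ (χ i))
  unfold energy
  convert h1

theorem energy_le_card (h : OrthoSigns w χ) (A : MemoryAlgorithm Ω t s ℓ ι) {m k : ℕ} (hm : 0 < m)
    (hx : k * ρ ^ 2 ≤ 1) (i : ι) :
    A.energy m k w ρ (χ i) ≤ m * (2 * (k * ρ ^ 2)) := by
  refine (A.energy_le h hm i).trans ?_
  have h1 : ∀ j : Fin m, ∑ y : Fin m → Fin k → Ω, prodWeight (prodWeight w) y *
      condEnergy (prodWeight w) (fun y' => A.blockTranscript m k (Function.update y j y'))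
        (fun y' => truncLikelihood ρ (χ i) y' - 1) ≤ 2 * (k * ρ ^ 2) := by
    intro j
    refine sum_mul_le_of_le (prodWeight_nonneg fun y => prodWeight_nonneg h.nonneg y)
      (sum_prodWeight (sum_prodWeight h.sum_one)) fun y => ?_
    simpa using h.condEnergy_truncLikelihood_le (κ := Fin k) (by simpa using hx) _ i
  refine (sum_le_sum fun j _ => h1 j).trans_eq ?_
  simp

theorem sum_energy_le [Fintype ι] (h : OrthoSigns w χ) (A : MemoryAlgorithm Ω t s ℓ ι) {m k : ℕ} (hm : 0 < m)
    (hρ0 : 0 ≤ ρ) (hρ1 : ρ ≤ 1) (hx : k * ρ ^ 2 ≤ 1) {η : ℝ}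
    (hη : ∀ i, ∑ y : Fin k → Ω,
      prodWeight w y * (if likelihood ρ (χ i) y < 1 / 2 then 1 else 0) ≤ η)
    (hb : 1 ≤ s * ℓ) (hk : 0 < k) (hbk : 2 * (s * ℓ) * Fintype.card ι ≤ k) :
    ∑ i, A.energy m k w ρ (χ i) ≤ m * (3 * (24 * (s * ℓ : ℕ) * (k * ρ ^ 2) +
        Fintype.card ι * ((k * ρ ^ 2) ^ 2 + η))) := by
  refine (sum_le_sum fun i _ => A.energy_le h hm i).trans ?_
  rw [sum_comm]
  set B : ℝ := 3 * (24 * (s * ℓ : ℕ) * (k * ρ ^ 2) + Fintype.card ι * ((k * ρ ^ 2) ^ 2 + η))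
  have h1 : ∀ j : Fin m, ∑ i, ∑ y : Fin m → Fin k → Ω, prodWeight (prodWeight w) y *
      condEnergy (prodWeight w) (fun y' => A.blockTranscript m k (Function.update y j y'))
        (fun y' => truncLikelihood ρ (χ i) y' - 1) ≤ B := by
    intro j
    rw [sum_comm]
    simp_rw [← mul_sum]
    refine sum_mul_le_of_le (prodWeight_nonneg fun y => prodWeight_nonneg h.nonneg y)
      (sum_prodWeight (sum_prodWeight h.sum_one)) fun y => ?_
    simpa [B] using h.sum_condEnergy_truncLikelihood_le (κ := Fin k) hρ0 hρ1 (by simpa using hx) hη hb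
      (by simpa using hk) (by simpa using hbk) _ (A.ncard_range_blockTranscript_le m k y j)
  refine (sum_le_sum fun j _ => h1 j).trans_eq ?_
  simp

/-- The probability that the algorithm outputs `i` when the data has the density `∏ v`. -/
def outputMass (A : MemoryAlgorithm Ω t s ℓ ι) (v : Ω → ℝ) (i : ι) : ℝ :=
  ∑ x : Fin t → Ω, (∏ j, v (x j)) * if A.run x = i then 1 else 0

theorem sum_outputMass [Fintype ι] (A : MemoryAlgorithm Ω t s ℓ ι) {v : Ω → ℝ} (hv : ∑ a, v a = 1) :
    ∑ i, A.outputMass v i = 1 := by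
  unfold outputMass
  rw [sum_comm]
  simp_rw [← mul_sum]
  simpa [prodWeight] using sum_prodWeight (κ := Fin t) hv

theorem le_energy (h : OrthoSigns w χ) (A : MemoryAlgorithm Ω t s ℓ ι) {m k : ℕ} (hm : 0 < m)
    (htmk : t ≤ m * k) (hρ0 : 0 ≤ ρ) (hρ1 : ρ ≤ 1) {η : ℝ} (i : ι)
    (hη : ∑ y : Fin k → Ω, prodWeight w y * (if likelihood ρ (χ i) y < 1 / 2 then 1 else 0) ≤ η)
    (hmη : m * η ≤ 0.05) (hA : 2 / 3 ≤ A.outputMass (fun a => w a * (1 + ρ * χ i a)) i) :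
    0.4 ≤ A.energy m k w ρ (χ i) + 1.7 * A.outputMass w i := by
  have : Nonempty (Fin m) := ⟨⟨0, hm⟩⟩
  have hW : ∀ y : Fin k → Ω, 0 ≤ prodWeight w y := fun y => prodWeight_nonneg h.nonneg y
  have hout : ∀ y : Fin m → Fin k → Ω,
      A.output (A.blockTranscript m k y (Fin.last _)) = A.run (unblock htmk y) := by
    intro y
    rw [A.blockTranscript_last htmk]; rfl
  have hone := h.one_le_sum_truncLikelihood (κ := Fin k) (ρ := ρ) i
  have hG := h.sum_truncLikelihood_le (κ := Fin k) hρ0 hρ1 i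
  have h1 := le_totalEnergy (P := Fin (ℓ * m + 1) → Memory s)
    (R := Compatible (blockPlayer ℓ m) (A.blockUpdate m k) A.init)
    (tr := A.blockTranscript m k) (fun y p => transcript_eq_iff y p)
    (W := prodWeight (κ := Fin k) w) (G := truncLikelihood ρ (χ i)) hW
    (sum_prodWeight h.sum_one) (fun y => le_max_right _ _) hone ?_
    (fun p => A.output (p (Fin.last _)) = i) ?_
  · simp_rw [hout] at h1
    have h2 : ∑ y : Fin m → Fin k → Ω,
        (if A.run (unblock htmk y) = i then 1 else 0) * prodWeight (prodWeight w) y =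
        A.outputMass w i := by
      rw [outputMass, ← sum_prod_unblock htmk h.sum_one]
      exact sum_congr rfl fun y _ => mul_comm _ _
    rw [h2] at h1
    unfold energy
    convert h1
  · rw [Fintype.card_fin]
    have h2 : ∑ y : Fin k → Ω, prodWeight w y * truncLikelihood ρ (χ i) y ≤ exp η := by
      linarith [add_one_le_exp η]
    refine (pow_le_pow_left₀ (by linarith) h2 m).trans ?_
    rw [← exp_nat_mul]
    refine (exp_le_exp.mpr hmη).trans ?_
    have := (abs_le.mp (abs_exp_sub_one_sub_id_le (x := 0.05) (by norm_num [abs_le]))).2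
    norm_num at this ⊢
    linarith
  · simp_rw [hout]
    -- The truncated density dominates the true one, so the success probability carries over as a
    -- lower bound.
    refine hA.trans ?_
    rw [outputMass, ← sum_prod_unblock htmk (h.sum_linear_likelihood ρ i)]
    refine sum_le_sum fun y _ => ?_
    rw [mul_comm]
    refine mul_le_mul_of_nonneg_left ?_ (by split_ifs <;> norm_num)
    refine prod_le_prod (fun b _ => ?_) fun b _ => ?_
    · rw [prod_mul_distrib]
      exact mul_nonneg (hW _) (h.likelihood_nonneg hρ0 hρ1 i (y b))
    · rw [prod_mul_distrib]
      exact mul_le_mul_of_nonneg_left (le_max_left _ _) (hW _)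

/-- Summing over `i` costs only `1.7`, because the output probabilities under the common null
distribution add up to one. -/
theorem card_le_of_outputMass [Fintype ι] (h : OrthoSigns w χ) (A : MemoryAlgorithm Ω t s ℓ ι) {m k : ℕ}
    (hm : 0 < m) (htmk : t ≤ m * k) (hρ0 : 0 ≤ ρ) (hρ1 : ρ ≤ 1) {η : ℝ}
    (hη : ∀ i, ∑ y : Fin k → Ω,
      prodWeight w y * (if likelihood ρ (χ i) y < 1 / 2 then 1 else 0) ≤ η)
    (hmη : m * η ≤ 0.05)
    (hA : ∀ i, 2 / 3 ≤ A.outputMass (fun a => w a * (1 + ρ * χ i a)) i) :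
    0.4 * Fintype.card ι ≤ ∑ i, A.energy m k w ρ (χ i) + 1.7 := by
  have h1 := sum_le_sum fun i (_ : i ∈ univ) => A.le_energy h hm htmk hρ0 hρ1 i (hη i) hmη (hA i)
  rw [sum_add_distrib, ← mul_sum, A.sum_outputMass h.sum_one, sum_const, nsmul_eq_mul,
    card_univ] at h1
  linarith

set_option maxHeartbeats 400000 in
/-- The lower bound for the product of data size, memory and number of passes, for an
identification problem given by orthonormal signs. -/
theorem card_le_mul_of_identifies [Fintype ι] (h : OrthoSigns w χ) (A : MemoryAlgorithm Ω t s ℓ ι)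
    (hs : 1 ≤ s) (hℓ : 1 ≤ ℓ) (hρ0 : 0 ≤ ρ) (hn : 1200 ≤ (Fintype.card ι : ℝ))
    (hρ : ρ * (Fintype.card ι : ℝ) ^ 3 ≤ 1)
    (hA : ∀ i, 2 / 3 ≤ A.outputMass (fun a => w a * (1 + ρ * χ i a)) i) :
    0 < ρ ∧ (Fintype.card ι : ℝ) ≤ 1000 * (t * (s * ℓ) * ρ ^ 2) := by
  set n : ℝ := (Fintype.card ι : ℝ) with hndef
  have hρpos : 0 < ρ := by
    refine hρ0.lt_of_ne' ?_
    rintro rfl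
    -- For `ρ = 0` all hypotheses coincide, and disjoint outputs cannot each have probability `2/3`.
    have h1 := sum_le_sum fun i (_ : i ∈ univ) => hA i
    simp only [zero_mul, add_zero, mul_one] at h1
    rw [A.sum_outputMass h.sum_one, sum_const, nsmul_eq_mul, card_univ, ← hndef] at h1
    linarith
  refine ⟨hρpos, ?_⟩
  by_contra! hcon
  have hb : 1 ≤ s * ℓ := Nat.mul_pos hs hℓ
  set b : ℕ := s * ℓ with hbdef
  have hbr : (1 : ℝ) ≤ b := by exact_mod_cast hb
  have hcon' : 1000 * (t * b * ρ ^ 2) < n := by rw [hbdef]; push_cast; linarith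
  have hρ2 : 0 < ρ ^ 2 := by positivity
  have hρ6 : ρ ^ 2 * n ^ 6 ≤ 1 := by
    have := pow_le_pow_left₀ (by positivity) hρ 2
    calc ρ ^ 2 * n ^ 6 = (ρ * n ^ 3) ^ 2 := by ring
      _ ≤ 1 := by simpa using this
  have hn5 : ρ ^ 2 * (8 * n ^ 3) ≤ 1 := by
    refine le_trans (mul_le_mul_of_nonneg_left ?_ hρ2.le) hρ6
    have h3 : 8 ≤ n ^ 3 := by nlinarith [pow_le_pow_left₀ (by norm_num) hn 3]
    calc 8 * n ^ 3 ≤ n ^ 3 * n ^ 3 := mul_le_mul_of_nonneg_right h3 (by positivity)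
      _ = n ^ 6 := by ring
  have hnpos : 0 < n := by linarith
  -- This places `x = k * ρ ^ 2` between `1 / (8 * n)` and `1 / (4 * n)`: small enough that `n * x ^
  -- 2 ≤ x / 4`, and that the Chernoff exponent `n ^ 2 * x - n / 2` with `lam = n` is at most `-n /
  -- 4`.
  set k : ℕ := ⌊1 / (4 * ρ ^ 2 * n)⌋₊ with hkdef
  have hk1 : (k : ℝ) ≤ 1 / (4 * ρ ^ 2 * n) := Nat.floor_le (by positivity)
  have hk2 : 1 / (4 * ρ ^ 2 * n) < k + 1 := Nat.lt_floor_add_one _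
  set x : ℝ := k * ρ ^ 2 with hx
  have hx1 : x * (4 * n) ≤ 1 := by
    rw [le_div_iff₀ (by positivity)] at hk1
    linarith
  have hx2 : 1 ≤ (x + ρ ^ 2) * (4 * n) := by
    rw [div_lt_iff₀ (by positivity)] at hk2
    linarith
  have hx0 : 0 ≤ x := by positivity
  have hρn : ρ ^ 2 * (8 * n) ≤ 1 := by
    refine le_trans (mul_le_mul_of_nonneg_left ?_ hρ2.le) hn5
    exact mul_le_mul_of_nonneg_left (le_self_pow₀ (by linarith) three_ne_zero) (by norm_num)
  have hx3 : 1 ≤ x * (8 * n) := by linarith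
  have hxs : x ≤ 1 / 4800 := by nlinarith
  have hkn : n ^ 2 ≤ k := by
    have h1 : (ρ ^ 2 * (8 * n)) * n ^ 2 ≤ (ρ ^ 2 * (8 * n)) * k := by
      calc (ρ ^ 2 * (8 * n)) * n ^ 2 = ρ ^ 2 * (8 * n ^ 3) := by ring
        _ ≤ 1 := hn5
        _ ≤ x * (8 * n) := hx3
        _ = _ := by rw [hx]; ring
    exact le_of_mul_le_mul_left h1 (by positivity)
  have hkpos : 0 < k := by
    have : (0 : ℝ) < k := by nlinarith
    exact_mod_cast this
  set m : ℕ := t / k + 1 with hm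
  have hmpos : 0 < m := Nat.succ_pos _
  have htmk : t ≤ m * k := by
    rw [hm]
    have := Nat.div_add_mod t k
    have := Nat.mod_lt t hkpos
    nlinarith
  have hmk : m * k ≤ t + k := by
    rw [hm, Nat.add_mul, one_mul]
    have := Nat.div_mul_le_self t k
    omega
  have hmx : m * x ≤ t * ρ ^ 2 + x := by
    have : (m : ℝ) * k ≤ t + k := by exact_mod_cast hmk
    calc m * x = (m * k) * ρ ^ 2 := by rw [hx]; ring
      _ ≤ (t + k) * ρ ^ 2 := mul_le_mul_of_nonneg_right this hρ2.le
      _ = _ := by rw [hx]; ring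
  have htρ : 1000 * (t * ρ ^ 2) ≤ n := by
    have : (t : ℝ) * ρ ^ 2 * 1 ≤ t * ρ ^ 2 * b := mul_le_mul_of_nonneg_left hbr (by positivity)
    linarith
  have hmn : (m : ℝ) ≤ n ^ 2 := by
    have h1 : (m : ℝ) * 1 ≤ m * (x * (8 * n)) := mul_le_mul_of_nonneg_left hx3 (by positivity)
    have h2 : m * x * (8 * n) ≤ (n / 1000 + 1 / 4800) * (8 * n) :=
      mul_le_mul_of_nonneg_right (by linarith) (by positivity)
    nlinarith
  set η : ℝ := exp (-(n / 4)) with hηdef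
  have hη0 : 0 < η := exp_pos _
  have hnη : n ^ 2 * η ≤ 0.05 := sq_mul_exp_neg_le hn
  have hmη : m * η ≤ 0.05 := (mul_le_mul_of_nonneg_right hmn hη0.le).trans hnη
  have hρ1 : ρ ≤ 1 / 2 := by nlinarith
  have hη : ∀ i, ∑ y : Fin k → Ω,
      prodWeight w y * (if likelihood ρ (χ i) y < 1 / 2 then 1 else 0) ≤ η := by
    intro i
    refine (h.sum_likelihood_lt_half_le (κ := Fin k) hρ0 hρ1 ?_ hnpos.le ?_ i).trans ?_
    · rw [Fintype.card_fin]; linarith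
    · calc (n * ρ) ^ 2 * n = (ρ ^ 2 * (8 * n ^ 3)) / 8 := by ring
        _ ≤ 1 := by linarith
    · rw [Fintype.card_fin, hηdef, exp_le_exp, ← hx]
      nlinarith
  have hcard := A.card_le_of_outputMass h hmpos htmk hρ0 (by linarith) hη hmη hA
  rw [← hndef] at hcard
  -- By the memory-free energy bound, too little data cannot succeed. Together with `hcon'` this
  -- gives `100 * b ≤ n`, hence the condition `2 * b * n ≤ k` of the level-one estimate.
  have htlow : 0.1 ≤ t * ρ ^ 2 := by
    have h1 : ∑ i, A.energy m k w ρ (χ i) ≤ n * (m * (2 * x)) := by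
      refine (sum_le_sum fun i _ => A.energy_le_card h hmpos
        (show (k : ℝ) * ρ ^ 2 ≤ 1 by linarith) i).trans_eq ?_
      rw [sum_const, nsmul_eq_mul, card_univ]
    by_contra! hlt
    have h2 : n * (m * (2 * x)) ≤ n * 0.3 := mul_le_mul_of_nonneg_left (by linarith) hnpos.le
    linarith
  have hbn : 100 * (b : ℝ) ≤ n := by
    have := mul_le_mul_of_nonneg_right htlow (show (0 : ℝ) ≤ b by positivity)
    linarith
  have hbk : 2 * b * Fintype.card ι ≤ k := by
    have h1 := mul_le_mul_of_nonneg_right hbn hnpos.le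
    have : 2 * (b : ℝ) * n ≤ k := by linarith
    rw [hndef] at this
    exact_mod_cast this
  have hsum := A.sum_energy_le h hmpos hρ0 (by linarith)
    (show (k : ℝ) * ρ ^ 2 ≤ 1 by linarith) hη hb hkpos hbk
  rw [← hndef, ← hx, ← hbdef] at hsum
  have hηx : n * η ≤ x := by
    have h1 : n * η * (8 * n) ≤ x * (8 * n) := by linarith
    exact le_of_mul_le_mul_right h1 (by positivity)
  have hxx : n * x ^ 2 ≤ x / 4 := by
    have := mul_le_mul_of_nonneg_right hx1 hx0
    linarith
  have hbx : x ≤ b * x := le_mul_of_one_le_left hx0 hbr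
  have h1 : 3 * (24 * b * x + n * (x ^ 2 + η)) ≤ 76 * b * x := by linarith
  have h2 := mul_le_mul_of_nonneg_left h1 (show (0 : ℝ) ≤ m by positivity)
  -- The padding block adds at most `x ≤ 1/4800` to `t * ρ ^ 2 ≥ 0.1`, hence the factor `1.01`; the
  -- energies then total at most `0.077 * n`, too little for `hcard`.
  have h3 : m * (76 * b * x) ≤ 76 * b * (1.01 * (t * ρ ^ 2)) := by
    calc m * (76 * b * x) = 76 * b * (m * x) := by ring
      _ ≤ _ := mul_le_mul_of_nonneg_left (by linarith) (by positivity)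
  linarith

end MemoryAlgorithm

/-! ### Parities -/

theorem parity_mul_parity {d : ℕ} (I J : Finset (Fin d)) (x : Cube d) :
    parity I x * parity J x = parity (symmDiff I J) x := by
  have h : ∀ K : Finset (Fin d), parity K x = ∏ i, if i ∈ K then ((x i : ℤ) : ℝ) else 1 := by
    intro K
    rw [parity, prod_ite_mem, univ_inter]
  rw [h, h, h, ← prod_mul_distrib]
  refine prod_congr rfl fun i _ => ?_
  have hx : ((x i : ℤ) : ℝ) * ((x i : ℤ) : ℝ) = 1 := by
    rcases Int.units_eq_one_or (x i) with h1 | h1 <;> simp [h1]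
  by_cases hI : i ∈ I <;> by_cases hJ : i ∈ J <;> simp [hI, hJ, mem_symmDiff, hx]

theorem orthoSigns_parity {d : ℕ} (U : Finset (Finset (Fin d))) (hU : ∀ I ∈ U, I.Nonempty) :
    OrthoSigns (fun _ : Cube d => ((2 : ℝ) ^ d)⁻¹) (fun I : U => parity I.1) where
  nonneg _ := by positivity
  sum_one := by simp
  sq_eq_one I a := by
    rcases parity_eq_or I.1 a with h | h <;> simp [h]
  mean_zero I := by
    rw [← mul_sum, sum_parity (hU I.1 I.2), mul_zero]
  orthogonal I J hIJ := by
    simp_rw [parity_mul_parity]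
    rw [← mul_sum, sum_parity, mul_zero]
    rw [nonempty_iff_ne_empty]
    intro h
    exact hIJ (Subtype.ext (symmDiff_eq_bot.mp h))

theorem outputMass_of_identifies {d t s ℓ : ℕ} {U : Finset (Finset (Fin d))}
    {hU : ∀ I ∈ U, I.Nonempty} {ρ : ℝ} {hρ : ρ ∈ Set.Icc (0 : ℝ) 1}
    {A : MemoryAlgorithm (Cube d) t s ℓ U} (hA : A.Identifies (parityFamily U hU ρ hρ) (1 / 3))
    (I : U) :
    2 / 3 ≤ A.outputMass (fun x => ((2 : ℝ) ^ d)⁻¹ * (1 + ρ * parity I.1 x)) I := by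
  classical
  have h := hA I
  have h1 : (((iidSample (parityFamily U hU ρ hρ I) t).map A.run) I).toReal =
      A.outputMass (fun x => ((2 : ℝ) ^ d)⁻¹ * (1 + ρ * parity I.1 x)) I := by
    rw [PMF.map_apply, tsum_fintype, ENNReal.toReal_sum]
    · refine sum_congr rfl fun x _ => ?_
      by_cases hx : A.run x = I
      · simp only [hx, if_true, mul_one]
        rw [iidSample, PMF.ofFintype_apply, ENNReal.toReal_prod]
        refine prod_congr rfl fun j _ => ?_
        rw [parityFamily, parityBiased, PMF.ofFintype_apply,
          ENNReal.toReal_ofReal (parityMass_nonneg _ hρ _), parityMass]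
        ring
      · simp [hx, Ne.symm hx]
    · intro x _
      split_ifs
      · exact PMF.apply_ne_top _ _
      · simp
  rw [h1] at h
  linarith

/-- Both logarithms are slack here: only `ρ * n ^ 3 ≤ 1` is used, and `log n ≥ 1` weakens the
conclusion. -/
theorem parity_lower_bound {d : ℕ} (U : Finset (Finset (Fin d))) (hU : ∀ I ∈ U, I.Nonempty)
    (ρ : ℝ) (hρ : ρ ∈ Set.Icc (0 : ℝ) 1) (hn : 1200 ≤ (U.card : ℝ))
    (hρU : ρ ≤ 1 / (1000 * (U.card : ℝ) ^ 3 * √(log U.card))) {t s ℓ : ℕ} (hs : 1 ≤ s)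
    (hℓ : 1 ≤ ℓ) (A : MemoryAlgorithm (Cube d) t s ℓ U)
    (hA : A.Identifies (parityFamily U hU ρ hρ) (1 / 3)) :
    0 < ρ ∧ (U.card : ℝ) / (1000 * log U.card * ρ ^ 2) ≤ (t : ℝ) * s * ℓ := by
  set n : ℝ := (U.card : ℝ) with hndef
  have hlog : 1 ≤ log n := by
    rw [le_log_iff_exp_le (by linarith)]
    linarith [exp_one_lt_d9]
  have hcard : (Fintype.card U : ℝ) = n := by simp [hndef]
  have hnpos : 0 < n := by linarith
  have hρn : ρ * n ^ 3 ≤ 1 := by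
    have h1 : 1 ≤ √(log n) := one_le_sqrt.mpr hlog
    rw [le_div_iff₀ (by positivity)] at hρU
    have h2 : ρ * n ^ 3 * 1 ≤ ρ * n ^ 3 * (1000 * √(log n)) :=
      mul_le_mul_of_nonneg_left (by linarith) (mul_nonneg hρ.1 (by positivity))
    linarith
  obtain ⟨h0, h1⟩ := A.card_le_mul_of_identifies (orthoSigns_parity U hU) hs hℓ hρ.1
    (by rw [hcard]; exact hn) (by rw [hcard]; exact hρn) (outputMass_of_identifies hA)
  refine ⟨h0, ?_⟩
  rw [hcard] at h1
  rw [div_le_iff₀ (by positivity)]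
  have h2 : (t : ℝ) * (s * ℓ) * ρ ^ 2 * 1 ≤ t * (s * ℓ) * ρ ^ 2 * log n :=
    mul_le_mul_of_nonneg_left hlog (by positivity)
  linarith

theorem pairs_lower_bound {d : ℕ} (ρ : ℝ) (hρ : ρ ∈ Set.Icc (0 : ℝ) 1) (hd : 100 ≤ d)
    (hρd : ρ ≤ 1 / (8000 * (d : ℝ) ^ 6 * √(log d))) {t s ℓ : ℕ} (hs : 1 ≤ s)
    (hℓ : 1 ≤ ℓ) (A : MemoryAlgorithm (Cube d) t s ℓ (coordPairs d))
    (hA : A.Identifies (parityFamily (coordPairs d) nonempty_of_mem_coordPairs ρ hρ) (1 / 3)) :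
    0 < ρ ∧ (d : ℝ) ^ 2 / (8000 * log d * ρ ^ 2) ≤ (t : ℝ) * s * ℓ := by
  have hd' : (100 : ℝ) ≤ d := by exact_mod_cast hd
  have hcard : ((coordPairs d).card : ℝ) = d * (d - 1) / 2 := by
    rw [coordPairs, card_powersetCard, card_univ, Fintype.card_fin, Nat.cast_choose_two]
  set n : ℝ := ((coordPairs d).card : ℝ) with hndef
  have hn : 1200 ≤ n := by rw [hcard]; nlinarith
  have hn1 : (d : ℝ) ^ 2 ≤ 4 * n := by rw [hcard]; nlinarith
  have hn2 : n ≤ (d : ℝ) ^ 2 := by rw [hcard]; nlinarith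
  have hnpos : 0 < n := by linarith
  have hlog : 0 < log n := log_pos (by linarith)
  have hlogn : log n ≤ 2 * log d := by
    have h1 := log_le_log hnpos hn2
    rw [log_pow] at h1
    exact_mod_cast h1
  have hsqrt : √(log n) ≤ 2 * √(log d) := by
    rw [show (2 : ℝ) * √(log d) = √(4 * log d) by
      rw [sqrt_mul (by norm_num)]; norm_num]
    exact sqrt_le_sqrt (by linarith)
  have hρU : ρ ≤ 1 / (1000 * n ^ 3 * √(log n)) := by
    refine hρd.trans (one_div_le_one_div_of_le (by positivity) ?_)
    have h1 : n ^ 3 ≤ (d : ℝ) ^ 6 := by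
      calc n ^ 3 ≤ ((d : ℝ) ^ 2) ^ 3 := pow_le_pow_left₀ hnpos.le hn2 3
        _ = (d : ℝ) ^ 6 := by ring
    have h2 : n ^ 3 * √(log n) ≤ (d : ℝ) ^ 6 * (2 * √(log d)) :=
      mul_le_mul h1 hsqrt (by positivity) (by positivity)
    have h3 : 0 ≤ (d : ℝ) ^ 6 * √(log d) := by positivity
    linarith
  obtain ⟨h0, h1⟩ := parity_lower_bound (coordPairs d) nonempty_of_mem_coordPairs ρ hρ hn hρU
    hs hℓ A hA
  refine ⟨h0, le_trans ?_ h1⟩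
  rw [← hndef, div_le_div_iff₀ (by nlinarith [sq_pos_of_pos h0]) (by positivity)]
  -- `8000` is `1000` times `4` from `d ^ 2 ≤ 4 * n` and `2` from `log n ≤ 2 * log d`.
  have h2 : (d : ℝ) ^ 2 * log n ≤ 4 * n * (2 * log d) :=
    mul_le_mul hn1 hlogn hlog.le (by positivity)
  have h3 := mul_le_mul_of_nonneg_right h2 (show 0 ≤ 1000 * ρ ^ 2 by positivity)
  linarith

end MemoryLowerBound

end

theorem theorem4 :
    (∃ C C' : ℝ, 0 < C ∧ 0 < C' ∧
      ∀ (d : ℕ) (U : Finset (Finset (Fin d))) (hU : ∀ I ∈ U, I.Nonempty)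
        (ρ : ℝ) (hρ : ρ ∈ Set.Icc (0 : ℝ) 1),
        C' ≤ (U.card : ℝ) →
        ρ ≤ 1 / (C * (U.card : ℝ) ^ 3 * √(Real.log U.card)) →
        ∀ t s ℓ : ℕ, 1 ≤ t → 1 ≤ s → 1 ≤ ℓ →
        ∀ A : MemoryLowerBound.MemoryAlgorithm (MemoryLowerBound.Cube d) t s ℓ U,
          A.Identifies (MemoryLowerBound.parityFamily U hU ρ hρ) (1 / 3) →
          0 < ρ ∧ (U.card : ℝ) / (C * Real.log U.card * ρ ^ 2) ≤ (t : ℝ) * s * ℓ) ∧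
    (∃ (C : ℝ) (d₀ : ℕ), 0 < C ∧
      ∀ (d : ℕ) (ρ : ℝ) (hρ : ρ ∈ Set.Icc (0 : ℝ) 1),
        d₀ ≤ d →
        ρ ≤ 1 / (C * (d : ℝ) ^ 6 * √(Real.log d)) →
        ∀ t s ℓ : ℕ, 1 ≤ t → 1 ≤ s → 1 ≤ ℓ →
        ∀ A : MemoryLowerBound.MemoryAlgorithm (MemoryLowerBound.Cube d) t s ℓ
            (MemoryLowerBound.coordPairs d),
          A.Identifies (MemoryLowerBound.parityFamily (MemoryLowerBound.coordPairs d)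
            MemoryLowerBound.nonempty_of_mem_coordPairs ρ hρ) (1 / 3) →
          0 < ρ ∧ (d : ℝ) ^ 2 / (C * Real.log d * ρ ^ 2) ≤ (t : ℝ) * s * ℓ) := by
  refine ⟨⟨1000, 1200, by norm_num, by norm_num, ?_⟩, 8000, 100, by norm_num, ?_⟩
  · intro d U hU ρ hρ hn hρU t s ℓ _ hs hℓ A hA
    exact MemoryLowerBound.parity_lower_bound U hU ρ hρ hn hρU hs hℓ A hA
  · intro d ρ hρ hd hρd t s ℓ _ hs hℓ A hA
    exact MemoryLowerBound.pairs_lower_bound ρ hρ hd hρd hs hℓ A hA
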